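/- Let $k$ be an algebraically closed field. A \emph{base category} is a category $P$ with zero morphisms such that different objects are not isomorphic, every endomorphism different from an identity is nilpotent, and for each object $x$ only finitely many non-zero morphisms start or end at $x$. A morphism is \emph{irreducible} if it is non-zero, non-invertible and not a composition of two non-invertible morphisms. The quiver $Q_P$ has the objects of $P$ as points and the irreducible morphisms as arrows; it is always assumed to be connected. A \emph{ray-category} is a base category $P$ such that (i) for each $x$ there is an integer $n\ge 1$ such that $P(x,x)=\{1,\alpha,\alpha^2,\dots,\alpha^n=0\}$ for some $\alpha$, with $n+1$ elements; (ii) for all $x,y$ there is $\mu\in P(x,y)$ with $P(x,y)=\mu\,P(x,x)$ or $P(x,y)=P(y,y)\,\mu$; (iii) $\nu\mu=\nu\lambda\mu\neq 0$ with an endomorphism $\lambda$ implies that $\lambda$ is an identity, and each of $\mu\nu_1=\mu\nu_2\ne0$ and $\nu_1\mu=\nu_2\mu\neq0$ implies $\nu_1=\nu_2$. A non-zero morphism is \emph{profound} if its compositions, on either side, with all irreducible morphisms are zero. A \emph{zigzag} of length $n\geq 1$ is a sequence $(\rho_1,\dots,\rho_n)$ of non-zero non-invertible morphisms such that $\rho_{2i-1}$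 and $\rho_{2i}$ always have the same codomain, $\rho_{2i}$ and $\rho_{2i+1}$ always have the same domain, and no $\rho_i$ factors through a neighbour $\rho_{i\pm1}$; it starts at the domain of $\rho_1$, and it is \emph{low} if no $\rho_i$ is profound. $P$ is \emph{weakly zigzag-finite} if at each point only finitely many low zigzags start. For a path $v=\alpha_n\cdots\alpha_1$ of $Q_P$ let $\vec v$ be the composition of its arrows in $P$ (an identity if $v$ has length $0$). A \emph{contour} is a pair $(v,w)$ of paths with the same start and the same end and $\vec v=\vec w\neq0$. A \emph{contour function} is a map $c$ from the set of contours to $k^*$ such that $c(u,w)=c(u,v)c(v,w)$ and $c(sv,sw)=c(v,w)=c(vt,wt)$ whenever all the pairs involved are contours. It is \emph{exact} if there is a function $e$ from the set of arrows of $Q_P$ to $k^*$ with $$c(\alpha_n\cdots\alpha_1,\beta_m\cdots\beta_1)=e(\alpha_n)\cdots e(\alpha_1)\,\bigl(e(\beta_m)\cdots e(\beta_1)\bigr)^{-1}$$ for all contours. Let $H(P)=C(P)/E(P)$, where $C(P)$ is the abelian group of contour functions under pointwise multiplication and $E(P)$ the subgroup of exact contour functions. \textbf{Theorem.} Let $P$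 be a weakly zigzag-finite ray-category such that at each point of its quiver at most three arrows start and at most three arrows end. Then $H(P)$ is trivial. -/

import Mathlib

open CategoryTheory CategoryTheory.Limits

attribute [-instance] CategoryTheory.catToReflQuiver

universe v u w

namespace RayCat

section Basic

variable {P : Type u} [Category.{v} P] [HasZeroMorphisms P]

/-- Irreducible morphisms: non-zero, non-invertible, and not a composition of two non-invertible
morphisms. -/
def IsIrred {x y : P} (f : x ⟶ y) : Prop :=
  f ≠ 0 ∧ ¬ IsIso f ∧ ∀ (z : P) (g : x ⟶ z) (h : z ⟶ y), g ≫ h = f → IsIso g ∨ IsIso h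

/-- Profound morphisms: non-zero and annihilated by all irreducible morphisms, on both sides. -/
def IsProfound {x y : P} (f : x ⟶ y) : Prop :=
  f ≠ 0 ∧ (∀ (z : P) (g : y ⟶ z), IsIrred g → f ≫ g = 0) ∧
    ∀ (z : P) (g : z ⟶ x), IsIrred g → g ≫ f = 0

end Basic

/-- The set of points of the quiver of `P` (a copy of the set of objects). -/
def QuiverOf (P : Type u) : Type u := P

section QuiverSec

variable (P : Type u) [Category.{v} P] [HasZeroMorphisms P]

/-- The quiver of `P`: the arrows are the irreducible morphisms. -/
instance : Quiver.{v} (QuiverOf P) where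
  Hom x y := {f : @Quiver.Hom P _ x y // IsIrred (P := P) f}

/-- The quiver of `P` maps to `P`, identically on points and arrows. -/
def QuiverOf.incl : QuiverOf P ⥤q P where
  obj x := x
  map f := f.1

variable {P}

/-- The morphism of `P` given by a path of its quiver (the composition of its arrows). -/
def pathMor {x y : QuiverOf P} (p : Quiver.Path x y) :
    (QuiverOf.incl P).obj x ⟶ (QuiverOf.incl P).obj y :=
  composePath ((QuiverOf.incl P).mapPath p)

end QuiverSec

/-- A base category: different objects are not isomorphic, all endomorphisms different from the
identity are nilpotent, only finitely many non-zero morphisms start or end at each object, and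
the quiver is connected. -/
structure IsBaseCategory (P : Type u) [Category.{v} P] [HasZeroMorphisms P] : Prop where
  skeletal : ∀ x y : P, Nonempty (x ≅ y) → x = y
  nilpotent : ∀ (x : P) (f : End x), f ≠ 1 → ∃ n : ℕ, f ^ n = (0 : x ⟶ x)
  finite_start : ∀ x : P, {a : Σ y : P, (x ⟶ y) | a.2 ≠ 0}.Finite
  finite_end : ∀ y : P, {a : Σ x : P, (x ⟶ y) | a.2 ≠ 0}.Finite
  connected : Subsingleton (Quiver.WeaklyConnectedComponent (QuiverOf P))

/-- A ray-category. -/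
structure IsRayCategory (P : Type u) [Category.{v} P] [HasZeroMorphisms P] : Prop
    extends IsBaseCategory P where
  /-- Each endomorphism monoid is `{1, α, α², …, αⁿ = 0}` with `n + 1` elements, `n ≥ 1`. -/
  end_cyclic : ∀ x : P, ∃ (n : ℕ) (α : End x), 1 ≤ n ∧ α ^ n = (0 : x ⟶ x) ∧
    (∀ f : End x, ∃ i ≤ n, f = α ^ i) ∧ ∀ i ≤ n, ∀ j ≤ n, α ^ i = α ^ j → i = j
  /-- Each morphism set is cyclic over the endomorphisms of the domain or of the codomain. -/
  hom_cyclic : ∀ x y : P,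
    (∃ f : x ⟶ y, ∀ g : x ⟶ y, ∃ r : x ⟶ x, g = r ≫ f) ∨
    (∃ f : x ⟶ y, ∀ g : x ⟶ y, ∃ r : y ⟶ y, g = f ≫ r)
  cancel_middle : ∀ {x y z : P} (f : x ⟶ y) (r : y ⟶ y) (g : y ⟶ z),
    f ≫ g = f ≫ r ≫ g → f ≫ g ≠ 0 → r = 𝟙 y
  cancel_left : ∀ {x y z : P} (f₁ f₂ : x ⟶ y) (g : y ⟶ z),
    f₁ ≫ g = f₂ ≫ g → f₁ ≫ g ≠ 0 → f₁ = f₂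
  cancel_right : ∀ {x y z : P} (f : x ⟶ y) (g₁ g₂ : y ⟶ z),
    f ≫ g₁ = f ≫ g₂ → f ≫ g₁ ≠ 0 → g₁ = g₂

section Zigzags

variable {P : Type u} [Category.{v} P] [HasZeroMorphisms P]

/-- The two morphisms have the same codomain and none of them factors through the other. -/
inductive SinkPair : Arrow P → Arrow P → Prop
  | mk {x y z : P} (f : x ⟶ z) (g : y ⟶ z)
      (hf : ∀ h : x ⟶ y, h ≫ g ≠ f) (hg : ∀ h : y ⟶ x, h ≫ f ≠ g) :
      SinkPair (Arrow.mk f) (Arrow.mk g)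

/-- The two morphisms have the same domain and none of them factors through the other. -/
inductive SourcePair : Arrow P → Arrow P → Prop
  | mk {x y z : P} (f : x ⟶ y) (g : x ⟶ z)
      (hf : ∀ h : z ⟶ y, g ≫ h ≠ f) (hg : ∀ h : y ⟶ z, f ≫ h ≠ g) :
      SourcePair (Arrow.mk f) (Arrow.mk g)

/-- A (finite) zigzag `(ρ₁, …, ρₙ)`, `n ≥ 1`: non-zero non-invertible morphisms such that
`ρ₂ᵢ₋₁` and `ρ₂ᵢ` have the same codomain, `ρ₂ᵢ` and `ρ₂ᵢ₊₁` have the same domain, and no `ρᵢ`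
factors through one of its neighbours. In the list, `ρᵢ` has index `i - 1`. -/
structure IsZigzag (l : List (Arrow P)) : Prop where
  ne_nil : l ≠ []
  proper : ∀ r ∈ l, r.hom ≠ 0 ∧ ¬ IsIso r.hom
  sink : ∀ (i : ℕ) (hi : i + 1 < l.length), Even i → SinkPair l[i] l[i + 1]
  source : ∀ (i : ℕ) (hi : i + 1 < l.length), Odd i → SourcePair l[i] l[i + 1]

/-- A low zigzag contains no profound morphism. -/
def IsLowZigzag (l : List (Arrow P)) : Prop :=
  IsZigzag l ∧ ∀ r ∈ l, ¬ IsProfound r.hom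

/-- The zigzag `l` starts at `x`: the domain of its first morphism is `x`. -/
def StartsAt (x : P) (l : List (Arrow P)) : Prop :=
  ∃ h : l ≠ [], (l.head h).left = x

variable (P)

/-- At each point only finitely many low zigzags start. -/
def IsWeaklyZigzagFinite : Prop :=
  ∀ x : P, {l : List (Arrow P) | IsLowZigzag l ∧ StartsAt x l}.Finite

/-- At each point of the quiver at most three arrows start and at most three arrows end. -/
def AtMostThreeArrows : Prop :=
  ∀ x : QuiverOf P, ENat.card (Quiver.Star x) ≤ 3 ∧ ENat.card (Quiver.Costar x) ≤ 3

end Zigzags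

section Contours

variable {P : Type u} [Category.{v} P] [HasZeroMorphisms P]

/-- Two parallel paths form a contour if they give the same non-zero morphism. -/
def IsContour {x y : QuiverOf P} (p q : Quiver.Path x y) : Prop :=
  pathMor p = pathMor q ∧ pathMor p ≠ 0

variable (P)

/-- The contours of `P`. -/
structure Contour where
  {src tgt : QuiverOf P}
  fst : Quiver.Path src tgt
  snd : Quiver.Path src tgt
  isContour : IsContour fst snd

variable {P}

/-- Contour functions with values in the non-zero scalars. -/
structure IsContourFunction {k : Type w} [Field k] (c : Contour P → kˣ) : Prop where
  trans : ∀ {x y : QuiverOf P} (p q r : Quiver.Path x y)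
    (hpr : IsContour p r) (hpq : IsContour p q) (hqr : IsContour q r),
    c ⟨p, r, hpr⟩ = c ⟨p, q, hpq⟩ * c ⟨q, r, hqr⟩
  comp_left : ∀ {x y z : QuiverOf P} (p q : Quiver.Path x y) (s : Quiver.Path y z)
    (h : IsContour p q) (hs : IsContour (p.comp s) (q.comp s)),
    c ⟨p.comp s, q.comp s, hs⟩ = c ⟨p, q, h⟩
  comp_right : ∀ {x y z : QuiverOf P} (t : Quiver.Path x y) (p q : Quiver.Path y z)
    (h : IsContour p q) (ht : IsContour (t.comp p) (t.comp q)),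
    c ⟨t.comp p, t.comp q, ht⟩ = c ⟨p, q, h⟩

variable (P)

/-- The group `C(P)` of contour functions under pointwise multiplication. -/
def contourFunctions (k : Type w) [Field k] : Subgroup (Contour P → kˣ) where
  carrier := {c | IsContourFunction c}
  one_mem' := ⟨by simp, by simp, by simp⟩
  mul_mem' := by
    intro a b ha hb
    refine ⟨?_, ?_, ?_⟩
    · intro x y p q r hpr hpq hqr
      simp only [Pi.mul_apply, ha.trans p q r hpr hpq hqr, hb.trans p q r hpr hpq hqr]
      exact mul_mul_mul_comm _ _ _ _
    · intro x y z p q s h hs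
      simp only [Pi.mul_apply, ha.comp_left p q s h hs, hb.comp_left p q s h hs]
    · intro x y z t p q h ht
      simp only [Pi.mul_apply, ha.comp_right t p q h ht, hb.comp_right t p q h ht]
  inv_mem' := by
    intro a ha
    refine ⟨?_, ?_, ?_⟩
    · intro x y p q r hpr hpq hqr
      simp only [Pi.inv_apply, ha.trans p q r hpr hpq hqr, mul_inv]
    · intro x y z p q s h hs
      simp only [Pi.inv_apply, ha.comp_left p q s h hs]
    · intro x y z t p q h ht
      simp only [Pi.inv_apply, ha.comp_right t p q h ht]

variable {P}

/-- The function `δ(e)` on contours: the product of the values of `e` on the arrows of the first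
path, divided by the product of the values of `e` on the arrows of the second path. -/
def delta {k : Type w} [Field k] (e : (x y : QuiverOf P) → (x ⟶ y) → kˣ) (C : Contour P) : kˣ :=
  C.fst.weight (fun {x y} a => e x y a) * (C.snd.weight (fun {x y} a => e x y a))⁻¹

theorem weight_mul {k : Type w} [Field k] (e e' : (x y : QuiverOf P) → (x ⟶ y) → kˣ)
    {x y : QuiverOf P} (p : Quiver.Path x y) :
    p.weight (fun {x y} a => e x y a * e' x y a) =
      p.weight (fun {x y} a => e x y a) * p.weight (fun {x y} a => e' x y a) := by
  induction p with
  | nil => simp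
  | cons p a ih =>
    simp only [Quiver.Path.weight_cons, ih]
    exact mul_mul_mul_comm _ _ _ _

theorem weight_inv {k : Type w} [Field k] (e : (x y : QuiverOf P) → (x ⟶ y) → kˣ)
    {x y : QuiverOf P} (p : Quiver.Path x y) :
    p.weight (fun {x y} a => (e x y a)⁻¹) = (p.weight (fun {x y} a => e x y a))⁻¹ := by
  induction p with
  | nil => simp
  | cons p a ih => simp only [Quiver.Path.weight_cons, ih, mul_inv]

theorem weight_one {k : Type w} [Field k] {x y : QuiverOf P} (p : Quiver.Path x y) :
    p.weight (fun {x y} (_ : x ⟶ y) => (1 : kˣ)) = 1 := by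
  induction p with
  | nil => simp
  | cons p a ih => simp only [Quiver.Path.weight_cons, ih, mul_one]

theorem delta_mem {k : Type w} [Field k] (e : (x y : QuiverOf P) → (x ⟶ y) → kˣ) :
    delta e ∈ contourFunctions P k := by
  refine ⟨?_, ?_, ?_⟩
  · intro x y p q r hpr hpq hqr
    simp [delta]
  · intro x y z p q s h hs
    simp [delta, Quiver.Path.weight_comp]
  · intro x y z t p q h ht
    simp only [delta, Quiver.Path.weight_comp, mul_inv]
    rw [mul_mul_mul_comm, mul_inv_cancel, one_mul]

variable (P)

/-- The group `E(P)` of exact contour functions, as a subgroup of `C(P)`. -/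
def exactContourFunctions (k : Type w) [Field k] : Subgroup (contourFunctions P k) where
  carrier := {c | ∃ e : (x y : QuiverOf P) → (x ⟶ y) → kˣ, c.1 = delta e}
  one_mem' := ⟨fun _ _ _ => 1, by funext C; simp only [delta, weight_one]; simp⟩
  mul_mem' := by
    rintro a b ⟨e, he⟩ ⟨e', he'⟩
    refine ⟨fun x y a => e x y a * e' x y a, ?_⟩
    funext C
    simp only [Subgroup.coe_mul, he, he', Pi.mul_apply, delta, weight_mul, mul_inv]
    exact mul_mul_mul_comm _ _ _ _
  inv_mem' := by
    rintro a ⟨e, he⟩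
    refine ⟨fun x y a => (e x y a)⁻¹, ?_⟩
    funext C
    simp only [Subgroup.coe_inv, he, Pi.inv_apply, delta, weight_inv, mul_inv]

/-- The group `H(P) = C(P) / E(P)`. -/
abbrev H (k : Type w) [Field k] : Type _ :=
  contourFunctions P k ⧸ exactContourFunctions P k

end Contours

end RayCat

/-! ### Cancellation systems, zigzags and potentials on finite ordered sets -/

namespace RayCat

/-! Choose a path for every non-zero non-invertible morphism. Comparing the product of the chosen
paths of two morphisms with the chosen path of their composition turns a contour function into a
2-cocycle on the pairs with non-zero composition (`IsRayCategory.isCocycle`), and the contour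
function is exact as soon as this cocycle is a coboundary (`IsRayCategory.exists_delta`). That every
cocycle is a coboundary is proved from cancellation and the absence of infinite low zigzags, hence
in the self-dual setting of a `CancelSystem`.

Because `kˣ` is divisible, it suffices to find primitives on finite sets
(`CancelSystem.exists_primitive`), and these sets can be taken closed. Let `S` be a minimal finite
closed set on which a cocycle is not exact. A primitive extends over a profound element if the
terminal factors of this element form a connected graph (`ExactOn.insert_profound`). It extends over
an object entered through a single element `γ` if the elements composable with `γ` form a connected
graph (`ZigzagFree.exactOn_of_filter`). So minimality forces all these graphs in `S` to be
disconnected, and dually: `S` and its opposite are `Tight`.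

Both the second extension result and the use of tightness rest on `ZigzagFree.exists_potential`:
without infinite low zigzags, a finite set ordered by initial factors is dismantlable by beat
points, so an additive function on comparable pairs is a difference of potentials.

In a tight set the disconnected graphs always allow a low zigzag to be prolonged
(`ZigzagFree.exists_step`). Doing this alternately in the system and in its opposite gives an
infinite low zigzag (`ZigzagFree.not_tight`), a contradiction. -/

/-- The non-zero non-invertible morphisms of a category with zero morphisms in which non-zero
compositions can be cancelled: `Comp a b c` says that `a` followed by `b` is the non-zero
morphism `c`. -/
structure CancelSystem (M : Type*) (O : Type*) where
  src : M → O
  tgt : M → O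
  Comp : M → M → M → Prop
  src_eq : ∀ {a b c}, Comp a b c → src c = src a
  tgt_eq : ∀ {a b c}, Comp a b c → tgt c = tgt b
  mid_eq : ∀ {a b c}, Comp a b c → tgt a = src b
  unique : ∀ {a b c c'}, Comp a b c → Comp a b c' → c = c'
  cancel_left : ∀ {a b b' c}, Comp a b c → Comp a b' c → b = b'
  cancel_right : ∀ {a a' b c}, Comp a b c → Comp a' b c → a = a'
  assoc : ∀ {a b c d e}, Comp a b d → Comp d c e → ∃ q, Comp b c q ∧ Comp a q e
  assoc' : ∀ {a b c q e}, Comp b c q → Comp a q e → ∃ d, Comp a b d ∧ Comp d c e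
  ne_left : ∀ {a b c}, Comp a b c → c ≠ a
  ne_right : ∀ {a b c}, Comp a b c → c ≠ b

namespace CancelSystem

variable {M O : Type*} (X : CancelSystem M O)

/-- The opposite system. -/
def op : CancelSystem M O where
  src := X.tgt
  tgt := X.src
  Comp a b c := X.Comp b a c
  src_eq h := X.tgt_eq h
  tgt_eq h := X.src_eq h
  mid_eq h := (X.mid_eq h).symm
  unique h h' := X.unique h h'
  cancel_left h h' := X.cancel_right h h'
  cancel_right h h' := X.cancel_left h h'
  assoc h h' := X.assoc' h h'
  assoc' h h' := X.assoc h h'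
  ne_left h := X.ne_right h
  ne_right h := X.ne_left h

/-- `a` is a proper initial factor of `b`. -/
def Pre (a b : M) : Prop := ∃ c, X.Comp a c b

/-- `a` divides some other element. -/
def Low (a : M) : Prop := ∃ b c, X.Comp a b c ∨ X.Comp b a c

/-- Elements with the same source, none of which is an initial factor of the other. -/
def SrcInc (a b : M) : Prop := X.src a = X.src b ∧ a ≠ b ∧ ¬ X.Pre a b ∧ ¬ X.Pre b a

/-- Elements with the same target, none of which is a terminal factor of the other. -/
def TgtInc (a b : M) : Prop := X.op.SrcInc a b

/-- There are no infinite zigzags of low elements. -/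
def ZigzagFree : Prop := ¬ ∃ r : ℕ → M, (∀ n, X.Low (r n)) ∧
  ∀ n, X.TgtInc (r (2 * n)) (r (2 * n + 1)) ∧ X.SrcInc (r (2 * n + 1)) (r (2 * n + 2))

variable {X}

theorem Pre.trans {a b c : M} (h : X.Pre a b) (h' : X.Pre b c) : X.Pre a c := by
  obtain ⟨d, hd⟩ := h
  obtain ⟨e, he⟩ := h'
  obtain ⟨q, -, hq⟩ := X.assoc hd he
  exact ⟨q, hq⟩

theorem Pre.ne {a b : M} (h : X.Pre a b) : a ≠ b := by
  obtain ⟨d, hd⟩ := h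
  exact (X.ne_left hd).symm

theorem not_pre_self (a : M) : ¬ X.Pre a a := fun h => h.ne rfl

theorem Pre.src_eq {a b : M} (h : X.Pre a b) : X.src b = X.src a := by
  obtain ⟨d, hd⟩ := h
  exact X.src_eq hd

theorem op_low {a : M} : X.op.Low a ↔ X.Low a := by
  constructor <;> rintro ⟨b, c, h | h⟩
  exacts [⟨b, c, .inr h⟩, ⟨b, c, .inl h⟩, ⟨b, c, .inr h⟩, ⟨b, c, .inl h⟩]

theorem ZigzagFree.op (hZ : X.ZigzagFree) : X.op.ZigzagFree := by
  rintro ⟨r, hl, hr⟩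
  -- Dropping the first term of a zigzag interchanges sinks and sources.
  refine hZ ⟨fun n => r (n + 1), fun n => op_low.1 (hl _), fun n => ⟨(hr n).2, (hr (n + 1)).1⟩⟩

/-- A process that continues a low zigzag indefinitely contradicts zigzag-freeness. -/
theorem ZigzagFree.false_of_step (hZ : X.ZigzagFree) {σ : Type*} [Nonempty σ] (e : σ → M)
    (hl : ∀ s, X.Low (e s))
    (step : ∀ s, ∃ s' r, X.Low r ∧ X.TgtInc (e s) r ∧ X.SrcInc r (e s')) : False := by
  choose nxt r hr ht hs using step
  let q : ℕ → σ := fun n => nxt^[n] (Classical.arbitrary σ)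
  have hq : ∀ n, q (n + 1) = nxt (q n) := fun n => Function.iterate_succ_apply' _ _ _
  refine hZ ⟨fun n => if n % 2 = 0 then e (q (n / 2)) else r (q (n / 2)), fun n => ?_,
    fun n => ⟨?_, ?_⟩⟩
  · dsimp only
    split_ifs
    exacts [hl _, hr _]
  · have h1 : (2 * n + 1) / 2 = n := by omega
    simpa [h1, Nat.add_mod] using ht (q n)
  · have h1 : (2 * n + 1) / 2 = n := by omega
    have h2 : (2 * n + 2) / 2 = n + 1 := by omega
    simpa [h1, h2, Nat.add_mod, hq] using hs (q n)

section Potential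

variable (X) in
/-- `b` covers `a` in the subset `V`, ordered by initial factors. -/
def Cov (V : Finset M) (a b : M) : Prop :=
  a ∈ V ∧ b ∈ V ∧ X.Pre a b ∧ ∀ w ∈ V, X.Pre a w → ¬ X.Pre w b

theorem exists_cov_right (V : Finset M) {a b : M} (ha : a ∈ V) (hb : b ∈ V) (h : X.Pre a b) :
    ∃ a', X.Cov V a' b ∧ (a = a' ∨ X.Pre a a') := by
  classical
  induction hn : (V.filter fun w => X.Pre a w ∧ X.Pre w b).card using Nat.strong_induction_on
    generalizing a with
  | _ n ih =>
    by_cases hc : ∀ w ∈ V, X.Pre a w → ¬ X.Pre w b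
    · exact ⟨a, ⟨ha, hb, h, hc⟩, .inl rfl⟩
    · push Not at hc
      obtain ⟨w, hw, haw, hwb⟩ := hc
      obtain ⟨a', h1, h2⟩ := ih _ (by
        rw [← hn]
        refine Finset.card_lt_card (Finset.ssubset_iff_of_subset ?_ |>.2 ⟨w, ?_, ?_⟩)
        · intro m hm
          simp only [Finset.mem_filter] at hm ⊢
          exact ⟨hm.1, haw.trans hm.2.1, hm.2.2⟩
        · simp [hw, haw, hwb]
        · simp [not_pre_self]) hw hwb rfl
      refine ⟨a', h1, .inr ?_⟩
      rcases h2 with rfl | h2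
      exacts [haw, haw.trans h2]

theorem exists_cov_left (V : Finset M) {a b : M} (ha : a ∈ V) (hb : b ∈ V) (h : X.Pre a b) :
    ∃ b', X.Cov V a b' ∧ (b' = b ∨ X.Pre b' b) := by
  classical
  induction hn : (V.filter fun w => X.Pre a w ∧ X.Pre w b).card using Nat.strong_induction_on
    generalizing b with
  | _ n ih =>
    by_cases hc : ∀ w ∈ V, X.Pre a w → ¬ X.Pre w b
    · exact ⟨b, ⟨ha, hb, h, hc⟩, .inl rfl⟩
    · push Not at hc
      obtain ⟨w, hw, haw, hwb⟩ := hc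
      obtain ⟨a', h1, h2⟩ := ih _ (by
        rw [← hn]
        refine Finset.card_lt_card (Finset.ssubset_iff_of_subset ?_ |>.2 ⟨w, ?_, ?_⟩)
        · intro m hm
          simp only [Finset.mem_filter] at hm ⊢
          exact ⟨hm.1, hm.2.1, hm.2.2.trans hwb⟩
        · simp [hw, haw, hwb]
        · simp [not_pre_self]) hw haw rfl
      refine ⟨a', h1, .inr ?_⟩
      rcases h2 with rfl | h2
      exacts [hwb, h2.trans hwb]

theorem Cov.srcInc_right {V : Finset M} {a b b' : M} (h : X.Cov V a b) (h' : X.Cov V a b')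
    (hne : b ≠ b') : X.SrcInc b b' :=
  ⟨h.2.2.1.src_eq.trans h'.2.2.1.src_eq.symm, hne, fun hp => h'.2.2.2 b h.2.1 h.2.2.1 hp,
    fun hp => h.2.2.2 b' h'.2.1 h'.2.2.1 hp⟩

theorem Cov.srcInc_left {V : Finset M} {a a' b : M} (h : X.Cov V a b) (h' : X.Cov V a' b)
    (hne : a ≠ a') : X.SrcInc a a' :=
  ⟨h.2.2.1.src_eq.symm.trans h'.2.2.1.src_eq, hne, fun hp => h.2.2.2 a' h'.1 hp h'.2.2.1,
    fun hp => h'.2.2.2 a h.1 hp h.2.2.1⟩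

/-- Terminal factors of incomparable initial factors of the same element are incomparable. -/
theorem SrcInc.tgtInc {a a' b b' c : M} (h : X.Comp a b c) (h' : X.Comp a' b' c)
    (hi : X.SrcInc a a') : X.TgtInc b b' := by
  refine ⟨(X.tgt_eq h).symm.trans (X.tgt_eq h'), ?_, ?_, ?_⟩
  · rintro rfl
    exact hi.2.1 (X.cancel_right h h')
  · rintro ⟨d, hd⟩
    obtain ⟨q, hq, hq'⟩ := X.assoc' hd h'
    obtain rfl := X.cancel_right hq' h
    exact hi.2.2.2 ⟨d, hq⟩
  · rintro ⟨d, hd⟩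
    obtain ⟨q, hq, hq'⟩ := X.assoc' hd h
    obtain rfl := X.cancel_right hq' h'
    exact hi.2.2.1 ⟨d, hq⟩

/-- The second factors of incomparable multiples of an element are incomparable. -/
theorem SrcInc.srcInc_of_comp {a b b' c c' : M} (h : X.Comp a b c) (h' : X.Comp a b' c')
    (hi : X.SrcInc c c') : X.SrcInc b b' := by
  refine ⟨(X.mid_eq h).symm.trans (X.mid_eq h'), ?_, ?_, ?_⟩
  · rintro rfl
    exact hi.2.1 (X.unique h h')
  · rintro ⟨d, hd⟩
    obtain ⟨q, hq, hq'⟩ := X.assoc' hd h'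
    obtain rfl := X.unique hq h
    exact hi.2.2.1 ⟨d, hq'⟩
  · rintro ⟨d, hd⟩
    obtain ⟨q, hq, hq'⟩ := X.assoc' hd h
    obtain rfl := X.unique hq h'
    exact hi.2.2.2 ⟨d, hq'⟩

/-- A finite set of elements that is not an antichain has an element with a unique lower or upper
cover. -/
theorem ZigzagFree.exists_beat_point (hZ : X.ZigzagFree) (V : Finset M) {a b : M} (ha : a ∈ V)
    (hb : b ∈ V) (hab : X.Pre a b) :
    ∃ v ∈ V, ∃ u ∈ V, (X.Pre u v ∧ ∀ w ∈ V, X.Pre w v → w = u ∨ X.Pre w u) ∨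
      (X.Pre v u ∧ ∀ w ∈ V, X.Pre v w → w = u ∨ X.Pre u w) := by
  by_contra hno
  have hr : ∀ a b, X.Cov V a b → ∃ a', a ≠ a' ∧ X.Cov V a' b := by
    intro a b h
    by_contra! hc
    refine hno ⟨b, h.2.1, a, h.1, .inl ⟨h.2.2.1, fun w hw hwb => ?_⟩⟩
    obtain ⟨a', h1, h2⟩ := exists_cov_right V hw h.2.1 hwb
    have : a = a' := by
      by_contra hne
      exact hc a' hne h1
    subst this
    exact h2
  have hl : ∀ a b, X.Cov V a b → ∃ b', b ≠ b' ∧ X.Cov V a b' := by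
    intro a b h
    by_contra! hc
    refine hno ⟨a, h.1, b, h.2.1, .inr ⟨h.2.2.1, fun w hw haw => ?_⟩⟩
    obtain ⟨b', h1, h2⟩ := exists_cov_left V h.1 hw haw
    have : b = b' := by
      by_contra hne
      exact hc b' hne h1
    subst this
    exact h2.imp Eq.symm id
  -- Without beat points one can walk down and up along covers forever. The quotients of successive
  -- covers form a low zigzag: two lower covers of one element give incomparable terminal factors,
  -- two upper covers give incomparable second factors.
  obtain ⟨a', h1, -⟩ := exists_cov_right V ha hb hab
  obtain ⟨c, hc⟩ := h1.2.2.1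
  have : Nonempty {s : M × M × M // X.Cov V s.1 s.2.1 ∧ X.Comp s.1 s.2.2 s.2.1} :=
    ⟨⟨(a', b, c), h1, hc⟩⟩
  refine hZ.false_of_step
    (σ := {s : M × M × M // X.Cov V s.1 s.2.1 ∧ X.Comp s.1 s.2.2 s.2.1}) (fun s => s.1.2.2)
    (fun s => ⟨_, _, .inr s.2.2⟩) ?_
  rintro ⟨⟨p, v, l⟩, h, hl'⟩
  obtain ⟨p', hne, hp'⟩ := hr _ _ h
  obtain ⟨v', hne', hv'⟩ := hl _ _ hp'
  obtain ⟨r, hr'⟩ := hp'.2.2.1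
  obtain ⟨l', hl''⟩ := hv'.2.2.1
  exact ⟨⟨(p', v', l'), hv', hl''⟩, r, ⟨_, _, .inr hr'⟩,
    (h.srcInc_left hp' hne).tgtInc hl' hr', (hp'.srcInc_right hv' hne').srcInc_of_comp hr' hl''⟩

/-- A function on pairs of comparable elements that is additive on chains is the difference of the
values of a potential. -/
theorem ZigzagFree.exists_potential (hZ : X.ZigzagFree) {A : Type*} [AddCommGroup A]
    (V : Finset M) (h : M → M → A)
    (hc : ∀ a ∈ V, ∀ b ∈ V, ∀ c ∈ V, X.Pre a b → X.Pre b c → h a c = h a b + h b c) :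
    ∃ φ : M → A, ∀ a ∈ V, ∀ b ∈ V, X.Pre a b → h a b = φ a - φ b := by
  classical
  induction hn : V.card using Nat.strong_induction_on generalizing V with
  | _ n ih =>
    by_cases hanti : ∀ a ∈ V, ∀ b ∈ V, ¬ X.Pre a b
    · exact ⟨0, fun a ha b hb hab => absurd hab (hanti a ha b hb)⟩
    push Not at hanti
    obtain ⟨a, ha, b, hb, hab⟩ := hanti
    obtain ⟨v, hv, u, hu, hvu⟩ := hZ.exists_beat_point V ha hb hab
    obtain ⟨φ, hφ⟩ := ih (V.erase v).card (by rw [← hn]; exact Finset.card_erase_lt_of_mem hv)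
      (V.erase v) (fun a ha b hb c hc' => hc a (Finset.mem_of_mem_erase ha) b
        (Finset.mem_of_mem_erase hb) c (Finset.mem_of_mem_erase hc')) rfl
    have huv : u ≠ v := by
      rcases hvu with h | h
      exacts [h.1.ne, h.1.ne.symm]
    have hφ' : ∀ a ∈ V, a ≠ v → ∀ b ∈ V, b ≠ v → X.Pre a b → h a b = φ a - φ b :=
      fun a ha hav b hb hbv =>
        hφ a (Finset.mem_erase.2 ⟨hav, ha⟩) b (Finset.mem_erase.2 ⟨hbv, hb⟩)
    rcases hvu with ⟨huv', hall⟩ | ⟨hvu', hall⟩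
    -- Everything below `v` lies below or equals `u`, so the value forced by the pair `u`, `v` is
    -- consistent with all other pairs; the case of a unique upper cover is dual.
    · refine ⟨Function.update φ v (φ u - h u v), fun a ha b hb hab => ?_⟩
      by_cases hav : a = v
      · subst hav
        have hba : b ≠ a := hab.ne.symm
        rw [Function.update_self, Function.update_of_ne hba]
        have h1 := hφ' u hu huv b hb hba (huv'.trans hab)
        rw [hc u hu a hv b hb huv' hab] at h1
        rw [sub_right_comm, ← h1]
        abel
      · rw [Function.update_of_ne hav]
        by_cases hbv : b = v
        · subst hbv
          rw [Function.update_self]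
          rcases hall a ha hab with rfl | hau
          · abel
          · rw [hc a ha u hu b hv hau huv', hφ' a ha hav u hu huv hau]
            abel
        · rw [Function.update_of_ne hbv]
          exact hφ' a ha hav b hb hbv hab
    · refine ⟨Function.update φ v (φ u + h v u), fun a ha b hb hab => ?_⟩
      by_cases hav : a = v
      · subst hav
        have hba : b ≠ a := hab.ne.symm
        rw [Function.update_self, Function.update_of_ne hba]
        rcases hall b hb hab with rfl | hub
        · abel
        · rw [hc a ha u hu b hb hvu' hub, hφ' u hu huv b hb hba hub]
          abel
      · rw [Function.update_of_ne hav]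
        by_cases hbv : b = v
        · subst hbv
          rw [Function.update_self]
          have h1 := hφ' a ha hav u hu huv (hab.trans hvu')
          rw [hc a ha b hv u hu hab hvu'] at h1
          rw [← sub_sub, ← h1]
          abel
        · rw [Function.update_of_ne hbv]
          exact hφ' a ha hav b hb hbv hab

end Potential

end CancelSystem

end RayCat

/-! ### Cocycles on closed sets and extension over a profound element -/

namespace RayCat

namespace CancelSystem

variable {M O : Type*} (X : CancelSystem M O) {A : Type*} [AddCommGroup A]

/-- A set of elements obtained by passing to a full subcategory and then to a quotient by an
ideal. -/
def Closed (S : Finset M) : Prop := ∀ {a b c}, X.Comp a b c → c ∈ S → (a ∈ S ↔ b ∈ S)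

/-- Two-cocycles. -/
def IsCocycle (f : M → M → A) : Prop := ∀ {a b c d e q}, X.Comp a b d → X.Comp d c e →
  X.Comp b c q → X.Comp a q e → f a b + f d c = f b c + f a q

/-- The restriction of `f` to `S` is a coboundary. -/
def ExactOn (f : M → M → A) (S : Finset M) : Prop :=
  ∃ g : M → A, ∀ {a b c}, a ∈ S → b ∈ S → c ∈ S → X.Comp a b c → f a b = g a + g b - g c

/-- Elements of `S` that are not compositions of elements of `S`. -/
def Irred (S : Finset M) (a : M) : Prop := a ∈ S ∧ ∀ b ∈ S, ∀ c ∈ S, ¬ X.Comp b c a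

/-- Elements of `S` without proper multiples in `S`. -/
def Profound (S : Finset M) (a : M) : Prop :=
  a ∈ S ∧ (∀ b, ∀ c ∈ S, ¬ X.Comp a b c) ∧ ∀ b, ∀ c ∈ S, ¬ X.Comp b a c

/-- The terminal factors of `m` in `S`. -/
def Tails (S : Finset M) (m : M) (b : M) : Prop := b ∈ S ∧ ∃ a, X.Comp a b m

/-- The elements that can be composed with `γ`; if `γ` is a loop, the endomorphisms are left
out. -/
def Heads (S : Finset M) (γ : M) (b : M) : Prop :=
  b ∈ S ∧ (∃ c ∈ S, X.Comp γ b c) ∧ (X.src γ = X.tgt γ → X.tgt b ≠ X.tgt γ)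

/-- All elements of `S` with the same target as `γ` factor through `γ`. -/
def OnlyEntry (S : Finset M) (γ : M) : Prop :=
  γ ∈ S ∧ ∀ m ∈ S, X.tgt m = X.tgt γ → m = γ ∨ ∃ a, X.Comp a γ m

/-- The graph with set of points `T` and edges `r` is not connected. -/
def Splits (T : M → Prop) (r : M → M → Prop) : Prop :=
  ∃ D : M → Prop, (∀ b b', T b → T b' → r b b' → (D b ↔ D b')) ∧ ∃ b b', T b ∧ T b' ∧ D b ∧ ¬ D b'

variable {X}

theorem eq_of_not_splits {B : Type*} {T : M → Prop} {r : M → M → Prop} (h : ¬ Splits T r) (k : M → B)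
    (hk : ∀ b b', T b → T b' → r b b' → k b = k b') {b b' : M} (hb : T b) (hb' : T b') :
    k b = k b' := by
  by_contra hne
  exact h ⟨fun m => k m = k b, fun m m' hm hm' hr => by simp only [hk m m' hm hm' hr],
    b, b', hb, hb', rfl, fun h => hne h.symm⟩

theorem Closed.op {S : Finset M} (hS : X.Closed S) : X.op.Closed S := fun h hc => (hS h hc).symm

theorem IsCocycle.op {f : M → M → A} (hf : X.IsCocycle f) : X.op.IsCocycle fun a b => f b a :=
  fun h1 h2 h3 h4 => (hf h3 h4 h1 h2).symm

theorem exactOn_op {f : M → M → A} {S : Finset M} (h : X.op.ExactOn (fun a b => f b a) S) :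
    X.ExactOn f S := by
  obtain ⟨g, hg⟩ := h
  exact ⟨g, fun {a b c} ha hb hc h => by rw [add_comm (g a)]; exact hg hb ha hc h⟩

theorem irred_op {S : Finset M} {a : M} : X.op.Irred S a ↔ X.Irred S a :=
  ⟨fun h => ⟨h.1, fun b hb c hc => h.2 c hc b hb⟩, fun h => ⟨h.1, fun b hb c hc => h.2 c hc b hb⟩⟩

variable (X) in
theorem wellFounded_pre (S : Finset M) :
    WellFounded fun a b => a ∈ S ∧ b ∈ S ∧ X.Pre a b := by
  classical
  refine Subrelation.wf ?_ (measure fun m => (S.filter fun a => X.Pre a m).card).wf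
  rintro a b ⟨ha, -, hab⟩
  refine Finset.card_lt_card (Finset.ssubset_iff_of_subset ?_ |>.2 ⟨a, ?_, ?_⟩)
  · intro m hm
    simp only [Finset.mem_filter] at hm ⊢
    exact ⟨hm.1, hm.2.trans hab⟩
  · simp [ha, hab]
  · simp [not_pre_self]

variable (X) in
theorem wellFounded_pre_flip (S : Finset M) :
    WellFounded fun a b => a ∈ S ∧ b ∈ S ∧ X.Pre b a := by
  classical
  refine Subrelation.wf ?_ (measure fun m => (S.filter fun a => X.Pre m a).card).wf
  rintro a b ⟨ha, -, hab⟩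
  refine Finset.card_lt_card (Finset.ssubset_iff_of_subset ?_ |>.2 ⟨a, ?_, ?_⟩)
  · intro m hm
    simp only [Finset.mem_filter] at hm ⊢
    exact ⟨hm.1, hab.trans hm.2⟩
  · simp [ha, hab]
  · simp [not_pre_self]

/-- Each element starts with an irreducible one. -/
theorem exists_irred_pre {S : Finset M} {m : M} (hm : m ∈ S) :
    ∃ α, X.Irred S α ∧ (α = m ∨ X.Pre α m) := by
  induction m using (X.wellFounded_pre S).induction with
  | _ m ih =>
    by_cases h : X.Irred S m
    · exact ⟨m, h, .inl rfl⟩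
    · simp only [Irred, hm, true_and, not_forall, not_not] at h
      obtain ⟨b, hb, c, -, hbc⟩ := h
      obtain ⟨α, hα, h⟩ := ih b ⟨hb, hm, ⟨c, hbc⟩⟩ hb
      refine ⟨α, hα, .inr ?_⟩
      rcases h with rfl | h
      exacts [⟨c, hbc⟩, h.trans ⟨c, hbc⟩]

/-- Each element ends with an irreducible one. -/
theorem exists_irred_tail {S : Finset M} {m : M} (hm : m ∈ S) :
    ∃ α, X.Irred S α ∧ (α = m ∨ ∃ a, X.Comp a α m) := by
  obtain ⟨α, hα, h⟩ := exists_irred_pre (X := X.op) hm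
  exact ⟨α, irred_op.1 hα, h⟩

/-- Each element has a multiple that has no proper multiple on the right. -/
theorem exists_right_maximal {S : Finset M} {m : M} (hm : m ∈ S) :
    ∃ m' ∈ S, (m' = m ∨ X.Pre m m') ∧ ∀ b, ∀ c ∈ S, ¬ X.Comp m' b c := by
  induction m using (X.wellFounded_pre_flip S).induction with
  | _ m ih =>
    by_cases h : ∀ b, ∀ c ∈ S, ¬ X.Comp m b c
    · exact ⟨m, hm, .inl rfl, h⟩
    · push Not at h
      obtain ⟨b, c, hc, hbc⟩ := h
      obtain ⟨m', hm', h1, h2⟩ := ih c ⟨hc, hm, ⟨b, hbc⟩⟩ hc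
      refine ⟨m', hm', .inr ?_, h2⟩
      rcases h1 with rfl | h1
      exacts [⟨b, hbc⟩, Pre.trans ⟨b, hbc⟩ h1]

/-- Each element divides a profound one. -/
theorem Closed.exists_profound {S : Finset M} (hS : X.Closed S) {m : M} (hm : m ∈ S) :
    ∃ m' ∈ S, (m' = m ∨ X.Pre m m') ∧
      ∃ μ, X.Profound S μ ∧ (μ = m' ∨ ∃ a, X.Comp a m' μ) := by
  obtain ⟨m', hm', h1, h2⟩ := exists_right_maximal (X := X) hm
  obtain ⟨μ, hμ, h3, h4⟩ := exists_right_maximal (X := X.op) hm'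
  refine ⟨m', hm', h1, μ, ⟨hμ, fun b c hc hbc => ?_, h4⟩, h3⟩
  rcases h3 with rfl | ⟨a, ha⟩
  · exact h2 b c hc hbc
  · change X.Comp a m' μ at ha
    obtain ⟨q, hq, hq'⟩ := X.assoc ha hbc
    exact h2 b q ((hS hq' hc).1 ((hS ha hμ).2 hm')) hq

/-- A profound element is never a proper factor of an element of the set, so erasing it affects no
factorization of another element. -/
theorem Closed.erase_profound [DecidableEq M] {S : Finset M} (hS : X.Closed S) {μ : M}
    (hμ : X.Profound S μ) : X.Closed (S.erase μ) := by
  intro a b c h hc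
  have hc' := Finset.mem_of_mem_erase hc
  have ha : a ≠ μ := by
    rintro rfl
    exact hμ.2.1 b c hc' h
  have hb : b ≠ μ := by
    rintro rfl
    exact hμ.2.2 a c hc' h
  simp [ha, hb, hS h hc']

/-- Exactness extends over a profound element with connected set of terminal factors. -/
theorem ExactOn.insert_profound [DecidableEq M] {S : Finset M} (hS : X.Closed S) {f : M → M → A}
    (hf : X.IsCocycle f) {μ : M} (hμ : X.Profound S μ)
    (hs : ¬ Splits (X.Tails S μ) X.op.Pre) (h : X.ExactOn f (S.erase μ)) : X.ExactOn f S := by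
  classical
  obtain ⟨g, hg⟩ := h
  have hg' : ∀ {a b c}, a ∈ S → b ∈ S → c ∈ S → c ≠ μ → X.Comp a b c →
      f a b = g a + g b - g c := by
    intro a b c ha hb hc hcμ h
    refine hg (Finset.mem_erase.2 ⟨?_, ha⟩) (Finset.mem_erase.2 ⟨?_, hb⟩)
      (Finset.mem_erase.2 ⟨hcμ, hc⟩) h
    · rintro rfl
      exact hμ.2.1 b c hc h
    · rintro rfl
      exact hμ.2.2 a c hc h
  choose! hd hhd using fun b (hb : X.Tails S μ b) => hb.2
  -- Each factorization of `μ` prescribes a value for the primitive at `μ`. The cocycle identity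
  -- shows that neighbouring terminal factors prescribe the same value, so connectedness leaves only
  -- one.
  have hk : ∀ b b', X.Tails S μ b → X.Tails S μ b' → X.op.Pre b b' →
      g (hd b) + g b - f (hd b) b = g (hd b') + g b' - f (hd b') b' := by
    rintro b b' hb hb' ⟨q, hq⟩
    change X.Comp q b b' at hq
    obtain ⟨d, hd1, hd2⟩ := X.assoc' hq (hhd b' hb')
    obtain rfl := X.cancel_right hd2 (hhd b hb)
    have m1 := (hS (hhd b' hb') hμ.1).2 hb'.1
    have m2 := (hS (hhd b hb) hμ.1).2 hb.1
    have m3 := (hS hq hb'.1).2 hb.1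
    have e1 := hg' m1 m3 m2 (X.ne_left (hhd b hb)).symm hd1
    have e2 := hg' m3 hb.1 hb'.1 (X.ne_right (hhd b' hb')).symm hq
    have e3 := hf hd1 (hhd b hb) hq (hhd b' hb')
    rw [e1, e2] at e3
    have e4 : f (hd b') b' = g (hd b') + g b' - (g (hd b) + g b - f (hd b) b) := by
      rw [eq_sub_of_add_eq' e3.symm]
      abel
    rw [e4]
    abel
  obtain ⟨κ, hκ⟩ : ∃ κ : A, ∀ b, X.Tails S μ b → g (hd b) + g b - f (hd b) b = κ := by
    by_cases hne : ∃ b, X.Tails S μ b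
    · obtain ⟨b₀, hb₀⟩ := hne
      exact ⟨_, fun b hb => eq_of_not_splits hs (fun b => g (hd b) + g b - f (hd b) b) hk hb hb₀⟩
    · exact ⟨0, fun b hb => absurd ⟨b, hb⟩ hne⟩
  refine ⟨Function.update g μ κ, fun {a b c} ha hb hc h => ?_⟩
  have haμ : a ≠ μ := by
    rintro rfl
    exact hμ.2.1 b c hc h
  have hbμ : b ≠ μ := by
    rintro rfl
    exact hμ.2.2 a c hc h
  rw [Function.update_of_ne haμ, Function.update_of_ne hbμ]
  by_cases hcμ : c = μ
  · subst hcμ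
    have hT : X.Tails S c b := ⟨hb, a, h⟩
    obtain rfl := X.cancel_right h (hhd b hT)
    rw [Function.update_self, ← hκ b hT]
    abel
  · rw [Function.update_of_ne hcμ]
    exact hg' ha hb hc hcμ h

end CancelSystem

end RayCat

/-! ### Extension over an object with a single entry -/

namespace RayCat

namespace CancelSystem

variable {M O : Type*} {X : CancelSystem M O} {A : Type*} [AddCommGroup A]

theorem Closed.filter_object [DecidableEq O] {S : Finset M} (hS : X.Closed S) (y : O) :
    X.Closed (S.filter fun m => X.src m ≠ y ∧ X.tgt m ≠ y) := by
  intro a b c h hc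
  simp only [Finset.mem_filter] at hc ⊢
  rw [hS h hc.1, ← X.src_eq h, ← X.tgt_eq h, X.mid_eq h]
  tauto

/-- A coboundary on the elements that do not touch `y` extends to the elements that start at `y`
but do not end there. -/
theorem ZigzagFree.exists_extend_start (hZ : X.ZigzagFree) [DecidableEq O] {S : Finset M}
    (hS : X.Closed S) {f : M → M → A} (hf : X.IsCocycle f) (y : O)
    (h : X.ExactOn f (S.filter fun m => X.src m ≠ y ∧ X.tgt m ≠ y)) :
    ∃ g : M → A, ∀ a b c, a ∈ S → b ∈ S → c ∈ S → X.tgt a ≠ y → X.tgt b ≠ y → X.Comp a b c →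
      f a b = g a + g b - g c := by
  classical
  obtain ⟨g, hg⟩ := h
  have hg' : ∀ {a b c}, a ∈ S → b ∈ S → c ∈ S → X.src a ≠ y → X.tgt a ≠ y → X.tgt b ≠ y →
      X.Comp a b c → f a b = g a + g b - g c := by
    intro a b c ha hb hc h1 h2 h3 h
    refine hg (Finset.mem_filter.2 ⟨ha, h1, h2⟩) (Finset.mem_filter.2 ⟨hb, ?_, h3⟩)
      (Finset.mem_filter.2 ⟨hc, ?_, ?_⟩) h
    · rwa [← X.mid_eq h]
    · rwa [X.src_eq h]
    · rwa [X.tgt_eq h]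
  choose! q hq using fun a b (h : X.Pre a b) => h
  -- For `a` and `b` starting at `y` with `b = a q`, the required difference of values is `f a q - g
  -- q`. By the cocycle identity it is additive along chains of initial factors.
  obtain ⟨p, hp⟩ := hZ.exists_potential (S.filter fun m => X.src m = y ∧ X.tgt m ≠ y)
    (fun a b => f a (q a b) - g (q a b)) (by
      intro a ha b hb c hc hab hbc
      simp only [Finset.mem_filter] at ha hb hc
      have h1 := hq a b hab
      have h2 := hq b c hbc
      have h3 := hq a c (hab.trans hbc)
      obtain ⟨r, hr, hr'⟩ := X.assoc h1 h2
      obtain rfl := X.cancel_left hr' h3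
      have e1 := hf h1 h2 hr h3
      rw [hg' ((hS h1 hb.1).1 ha.1) ((hS h2 hc.1).1 hb.1) ((hS h3 hc.1).1 ha.1)
        (by rw [← X.mid_eq h1]; exact ha.2.2) (by rw [← X.tgt_eq h1]; exact hb.2.2)
        (by rw [← X.tgt_eq h2]; exact hc.2.2) hr] at e1
      rw [← sub_eq_iff_eq_add'.2 e1]
      abel)
  refine ⟨fun m => if X.src m = y then p m else g m, fun a b c ha hb hc h1 h2 h => ?_⟩
  have hb' : X.src b ≠ y := by rwa [← X.mid_eq h]
  have hc' : X.src c = X.src a := X.src_eq h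
  have hct : X.tgt c ≠ y := by rwa [X.tgt_eq h]
  by_cases hay : X.src a = y
  · have hcy := hc'.trans hay
    have hpre : X.Pre a c := ⟨b, h⟩
    have e := hp a (Finset.mem_filter.2 ⟨ha, hay, h1⟩) c (Finset.mem_filter.2 ⟨hc, hcy, hct⟩) hpre
    obtain rfl := X.cancel_left h (hq a c hpre)
    simp only [hay, hcy, hb', if_true, if_false]
    rw [sub_eq_iff_eq_add.1 e]
    abel
  · have hcy : X.src c ≠ y := by rwa [hc']
    simp only [hay, hcy, hb', if_false]
    exact hg' ha hb hc hay h1 h2 h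

/-- Exactness extends over an object that is entered through one element only, if the set of
elements that can be composed with that element is connected. -/
theorem ZigzagFree.exactOn_of_filter (hZ : X.ZigzagFree) [DecidableEq O] {S : Finset M}
    (hS : X.Closed S) {f : M → M → A} (hf : X.IsCocycle f) {γ : M} (hγ : X.OnlyEntry S γ)
    (hs : ¬ Splits (X.Heads S γ) X.Pre)
    (hex : X.ExactOn f (S.filter fun m => X.src m ≠ X.tgt γ ∧ X.tgt m ≠ X.tgt γ)) :
    X.ExactOn f S := by
  classical
  obtain ⟨g, hg⟩ := hZ.exists_extend_start hS hf _ hex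
  clear hex
  set y := X.tgt γ with hy
  choose! γm hγm using fun b (hb : ∃ c ∈ S, X.Comp γ b c) => hb
  choose! pa hpa using fun m (hm : ∃ a, X.Comp a γ m) => hm
  -- The value that the composition of `γ` and `b` prescribes at `γ`.
  let k : M → A := fun b => f γ b - g b + g (γm b)
  have hk : ∀ b b', b ∈ S → b' ∈ S → X.tgt b ≠ y → X.tgt b' ≠ y → (∃ c ∈ S, X.Comp γ b c) →
      (∃ c ∈ S, X.Comp γ b' c) → X.Pre b b' → k b = k b' := by
    rintro b b' hb hb' hty hty' hex hex' ⟨c, hc⟩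
    obtain ⟨m1, h1⟩ := hγm b hex
    obtain ⟨m2, h2⟩ := hγm b' hex'
    obtain ⟨d, hd1, hd2⟩ := X.assoc' hc h2
    obtain rfl := X.unique hd1 h1
    have hcS := (hS hc hb').1 hb
    have htc : X.tgt c ≠ y := by rwa [← X.tgt_eq hc]
    have e1 := hf h1 hd2 hc h2
    rw [hg b c b' hb hcS hb' hty htc hc,
      hg _ c _ m1 hcS m2 (by rwa [X.tgt_eq h1]) htc hd2] at e1
    simp only [k]
    rw [eq_sub_of_add_eq e1]
    abel
  -- The function `g` is controlled only away from elements ending at `y`. If `γ` is not a loop, a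
  -- head `b` that ends at `y` is therefore replaced by `b₀` with `b = b₀ γ`; then `b₀` no longer
  -- ends at `y`.
  have hnorm : ∀ b, X.Heads S γ b → ∃ b₀ ∈ S, X.tgt b₀ ≠ y ∧ (∃ c ∈ S, X.Comp γ b₀ c) ∧
      (if X.tgt b = y then pa b else b) = b₀ ∧
      ((X.tgt b ≠ y ∧ b₀ = b) ∨ (X.tgt b = y ∧ X.Comp b₀ γ b)) := by
    rintro b ⟨hb, hex, hloop⟩
    by_cases hby : X.tgt b = y
    · have hne : X.src γ ≠ y := fun hc => hloop hc hby
      obtain ⟨c, hc, hγc⟩ := hex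
      have hex' : ∃ a, X.Comp a γ b := by
        rcases hγ.2 b hb hby with rfl | h
        · exact absurd (X.mid_eq hγc).symm hne
        · exact h
      have hab := hpa b hex'
      obtain ⟨d, hd1, hd2⟩ := X.assoc' hab hγc
      exact ⟨pa b, (hS hab hb).2 hγ.1, by rwa [X.mid_eq hab], ⟨d, (hS hd2 hc).2 hγ.1, hd1⟩,
        by rw [if_pos hby], .inr ⟨hby, hab⟩⟩
    · exact ⟨b, hb, hby, hex, by rw [if_neg hby], .inl ⟨hby, rfl⟩⟩
  have hconst : ∀ b b', X.Heads S γ b → X.Heads S γ b' → X.Pre b b' →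
      k (if X.tgt b = y then pa b else b) = k (if X.tgt b' = y then pa b' else b') := by
    rintro b b' hb hb' ⟨c, hc⟩
    obtain ⟨b₀, m, ht, hex, e, h⟩ := hnorm b hb
    obtain ⟨b₀', m', ht', hex', e', h'⟩ := hnorm b' hb'
    rw [e, e']
    obtain ⟨c', hc'⟩ : X.Pre b₀ b' := by
      rcases h with ⟨-, rfl⟩ | ⟨-, h⟩
      · exact ⟨c, hc⟩
      · exact Pre.trans ⟨γ, h⟩ ⟨c, hc⟩
    have hcS : c' ∈ S := (hS hc' hb'.1).1 m
    rcases h' with ⟨-, rfl⟩ | ⟨hby, h'⟩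
    · exact hk _ _ m m' ht ht' hex hex' ⟨c', hc'⟩
    · rcases hγ.2 c' hcS ((X.tgt_eq hc').symm.trans hby) with rfl | ⟨a, ha⟩
      · rw [X.cancel_right h' hc']
      · obtain ⟨d, hd1, hd2⟩ := X.assoc' ha hc'
        obtain rfl := X.cancel_right hd2 h'
        exact hk _ _ m m' ht ht' hex hex' ⟨a, hd1⟩
  obtain ⟨θ, hθ⟩ : ∃ θ : A, ∀ b ∈ S, X.tgt b ≠ y → (∃ c ∈ S, X.Comp γ b c) → k b = θ := by
    by_cases hne : ∃ b, X.Heads S γ b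
    · obtain ⟨b₀, hb₀⟩ := hne
      refine ⟨k (if X.tgt b₀ = y then pa b₀ else b₀), fun b hb hby hex => ?_⟩
      have e := eq_of_not_splits hs (fun b => k (if X.tgt b = y then pa b else b)) hconst
        ⟨hb, hex, fun _ => hby⟩ hb₀
      rw [if_neg hby] at e
      exact e
    · exact ⟨0, fun b hb hby hex => absurd ⟨b, hb, hex, fun _ => hby⟩ hne⟩
  -- Elements ending at `y` other than `γ` have the form `a γ`, with `a` unique by cancellation. So
  -- the values on them are forced, by recursion on initial factors.
  obtain ⟨G, hG1, hG2, hG3⟩ : ∃ G : M → A, (∀ m, X.tgt m ≠ y → G m = g m) ∧ G γ = θ ∧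
      ∀ a m, m ∈ S → X.Comp a γ m → G m = G a + θ - f a γ := by
    let F : (m : M) → ((a : M) → (a ∈ S ∧ m ∈ S ∧ X.Pre a m) → A) → A := fun m r =>
      if X.tgt m ≠ y then g m else if m = γ then θ else
        if h : m ∈ S ∧ ∃ a, X.Comp a γ m then
          r (pa m) ⟨(hS (hpa m h.2) h.1).2 hγ.1, h.1, ⟨γ, hpa m h.2⟩⟩ + θ - f (pa m) γ
        else 0
    refine ⟨(X.wellFounded_pre S).fix F, fun m hm => ?_, ?_, fun a m hm h => ?_⟩
    · rw [WellFounded.fix_eq]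
      simp only [F, if_pos hm]
    · rw [WellFounded.fix_eq]
      simp [F, ← hy]
    · rw [WellFounded.fix_eq]
      have h1 : X.tgt m = y := X.tgt_eq h
      have h2 : m ≠ γ := X.ne_right h
      have h3 : m ∈ S ∧ ∃ a, X.Comp a γ m := ⟨hm, a, h⟩
      obtain rfl : pa m = a := X.cancel_right (hpa m h3.2) h
      simp only [F, h1, h2, ne_eq, not_true_eq_false, if_false, dif_pos h3]
  -- The coboundary equation is first checked for `b` not ending at `y`, by splitting copies of `γ`
  -- off the end of `a`; the other `b` are reduced to this case or to `b = γ`.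
  have hGA : ∀ a b c, a ∈ S → b ∈ S → c ∈ S → X.tgt b ≠ y → X.Comp a b c →
      f a b = G a + G b - G c := by
    intro a
    induction a using (X.wellFounded_pre S).induction with
    | _ a ih =>
      intro b c ha hb hc hby h
      have hcy : X.tgt c ≠ y := by rwa [X.tgt_eq h]
      by_cases hay : X.tgt a = y
      · rcases hγ.2 a ha hay with rfl | ⟨d, hd⟩
        · have e := hθ b hb hby ⟨c, hc, h⟩
          have e' := (hγm b ⟨c, hc, h⟩).2
          obtain rfl := X.unique h e'
          rw [hG2, hG1 b hby, hG1 _ hcy, ← e]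
          simp only [k]
          abel
        · obtain ⟨q, hq1, hq2⟩ := X.assoc hd h
          have hdS := (hS hd ha).2 hγ.1
          have hqS := (hS hq2 hc).1 hdS
          have hqy : X.tgt q ≠ y := by rwa [X.tgt_eq hq1]
          have e1 := hf hd h hq1 hq2
          have e2 : f γ b = θ + G b - G q := by
            have e := hθ b hb hby ⟨q, hqS, hq1⟩
            have e' := (hγm b ⟨q, hqS, hq1⟩).2
            obtain rfl := X.unique hq1 e'
            rw [hG1 b hby, hG1 _ hqy, ← e]
            simp only [k]
            abel
          have e3 := ih d ⟨hdS, ha, ⟨γ, hd⟩⟩ q c hdS hqS hc hqy hq2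
          rw [e2, e3] at e1
          rw [eq_sub_of_add_eq' e1, hG3 d a ha hd]
          abel
      · rw [hG1 a hay, hG1 b hby, hG1 c hcy]
        exact hg a b c ha hb hc hay hby h
  refine ⟨G, fun {a b c} ha hb hc h => ?_⟩
  revert a c
  induction b using (X.wellFounded_pre S).induction with
  | _ b ih =>
    intro a c ha hc h
    by_cases hby : X.tgt b = y
    · rcases hγ.2 b hb hby with rfl | ⟨d, hd⟩
      · rw [hG3 a c hc h, hG2]
        abel
      · obtain ⟨q, hq1, hq2⟩ := X.assoc' hd h
        have hdS := (hS hd hb).2 hγ.1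
        have hqS := (hS hq2 hc).2 hγ.1
        have e1 := hf hq1 hq2 hd h
        have e2 := ih d ⟨hdS, hb, ⟨γ, hd⟩⟩ hdS ha hqS hq1
        rw [e2] at e1
        rw [← sub_eq_iff_eq_add'.2 e1, hG3 d b hb hd, hG3 q c hc hq2]
        abel
    · exact hGA a b c ha hb hc hby h

end CancelSystem

end RayCat

/-! ### Tight sets and the construction of an infinite zigzag -/

namespace RayCat

namespace CancelSystem

variable {M O : Type*} {X : CancelSystem M O} {A : Type*} [AddCommGroup A]

variable (X) in
/-- The properties of a minimal closed set on which a cocycle is not exact. -/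
structure Tight (S : Finset M) : Prop where
  closed : X.Closed S
  splits_tails : ∀ μ, X.Profound S μ → Splits (X.Tails S μ) X.op.Pre
  splits_heads : ∀ γ, X.OnlyEntry S γ → Splits (X.Heads S γ) X.Pre

variable (X) in
/-- The elements with the same source as `γ`, without `γ` itself and without the endomorphisms in
case `γ` is a loop. -/
def Around (S : Finset M) (γ m : M) : Prop :=
  m ∈ S ∧ X.src m = X.src γ ∧ m ≠ γ ∧ (X.src γ = X.tgt γ → X.tgt m ≠ X.tgt γ)

/-- Splitting off `γ` at the end leaves an element with the same target, since `γ` is a loop. The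
process stops, so the elements ending there are powers of `γ`. -/
theorem OnlyEntry.eq_or_pre_of_loop {S : Finset M} {γ : M} (hγ : X.OnlyEntry S γ)
    (hS : X.Closed S) (hl : X.src γ = X.tgt γ) {m : M} (hm : m ∈ S) (ht : X.tgt m = X.tgt γ) :
    m = γ ∨ X.Pre γ m := by
  induction m using (X.wellFounded_pre S).induction with
  | _ m ih =>
    rcases hγ.2 m hm ht with h | ⟨a, ha⟩
    · exact .inl h
    · have haS := (hS ha hm).2 hγ.1
      rcases ih a ⟨haS, hm, ⟨γ, ha⟩⟩ haS ((X.mid_eq ha).trans hl) with rfl | h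
      · exact .inr ⟨a, ha⟩
      · exact .inr (h.trans ⟨γ, ha⟩)

/-- If the elements that can be composed with `γ` are not connected, then removing `γ` separates
multiples of `γ` from each other. -/
theorem ZigzagFree.exists_separator (hZ : X.ZigzagFree) {S : Finset M} (hS : X.Closed S) {γ : M}
    (hγ : X.Irred S γ) (hs : Splits (X.Heads S γ) X.Pre) :
    ∃ φ : M → ℤ, (∀ m m', X.Around S γ m → X.Around S γ m' → X.Pre m m' → φ m = φ m') ∧
      ∃ c c', X.Around S γ c ∧ X.Around S γ c' ∧ X.Pre γ c ∧ X.Pre γ c' ∧ φ c ≠ φ c' := by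
  classical
  obtain ⟨D, hD, b, b', hb, hb', hDb, hDb'⟩ := hs
  choose! q hq using fun a b (h : X.Pre a b) => h
  have hheads : ∀ m, X.Around S γ m → X.Pre γ m → X.Heads S γ (q γ m) := by
    intro m hm h
    have h' := hq γ m h
    exact ⟨(hS h' hm.1).1 hγ.1, ⟨m, hm.1, h'⟩, fun hl => by rw [← X.tgt_eq h']; exact hm.2.2.2 hl⟩
  have hnot : ∀ m, m ∈ S → ¬ X.Pre m γ := by
    rintro m hm ⟨c, hc⟩
    exact hγ.2 m hm c ((hS hc hγ.1).1 hm) hc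
  -- The chosen function vanishes on pairs not starting at `γ`, and for pairs starting at `γ` it
  -- indicates the part `D` of the splitting to which the quotient belongs. It is additive because
  -- `D` is a union of components. Its potential is constant along comparabilities that avoid `γ`
  -- and tells multiples of `γ` in different parts from each other.
  obtain ⟨φ, hφ⟩ := hZ.exists_potential (S.filter fun m => m = γ ∨ X.Around S γ m)
    (fun a b => if a = γ ∧ D (q a b) then (1 : ℤ) else 0) (by
      intro a ha b hb c hc hab hbc
      simp only [Finset.mem_filter] at ha hb hc
      have hbγ : b ≠ γ := by
        rintro rfl
        exact hnot a ha.1 hab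
      have hcγ : c ≠ γ := by
        rintro rfl
        exact hnot b hb.1 hbc
      simp only [hbγ, false_and, if_false, add_zero]
      by_cases haγ : a = γ
      · subst haγ
        have hb2 := hb.2.resolve_left hbγ
        have hc2 := hc.2.resolve_left hcγ
        have hac := hab.trans hbc
        have h1 := hq a b hab
        obtain ⟨r, hr, hr'⟩ := X.assoc h1 (hq b c hbc)
        obtain rfl := X.cancel_left hr' (hq a c hac)
        simp only [true_and, hD _ _ (hheads b hb2 hab) (hheads c hc2 hac) ⟨_, hr⟩]
      · simp [haγ])
  have hmem : ∀ m, X.Around S γ m → m ∈ S.filter fun m => m = γ ∨ X.Around S γ m :=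
    fun m hm => Finset.mem_filter.2 ⟨hm.1, .inr hm⟩
  have hmγ : γ ∈ S.filter fun m => m = γ ∨ X.Around S γ m :=
    Finset.mem_filter.2 ⟨hγ.1, .inl rfl⟩
  refine ⟨φ, fun m m' hm hm' h => ?_, ?_⟩
  · have e := hφ m (hmem m hm) m' (hmem m' hm') h
    simp only [hm.2.2.1, false_and, if_false] at e
    omega
  · have key : ∀ b, X.Heads S γ b → ∃ c, X.Around S γ c ∧ X.Pre γ c ∧
        φ γ - φ c = if D b then 1 else 0 := by
      rintro b ⟨hb, ⟨c, hc, hbc⟩, hl⟩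
      have hpre : X.Pre γ c := ⟨b, hbc⟩
      have hc' : X.Around S γ c :=
        ⟨hc, X.src_eq hbc, X.ne_left hbc, fun h => by rw [X.tgt_eq hbc]; exact hl h⟩
      refine ⟨c, hc', hpre, ?_⟩
      have e := hφ γ hmγ c (hmem c hc') hpre
      obtain rfl := X.cancel_left hbc (hq γ c hpre)
      simpa using e.symm
    obtain ⟨c, h1, h2, h3⟩ := key b hb
    obtain ⟨c', h1', h2', h3'⟩ := key b' hb'
    rw [if_pos hDb] at h3
    rw [if_neg hDb'] at h3'
    exact ⟨c, c', h1, h1', h2, h2', by omega⟩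

/-- Otherwise `γ` would be a terminal factor of, or equal to, every terminal factor of `μ`, and
would connect the graph of these factors. -/
theorem Tight.tgt_ne_of_profound {S : Finset M} (hT : X.Tight S) {γ μ : M}
    (hγ : X.OnlyEntry S γ) (hμ : X.Profound S μ) : X.tgt μ ≠ X.tgt γ := by
  intro hy
  obtain ⟨D, hD, b, b', hb, hb', hDb, hDb'⟩ := hT.splits_tails μ hμ
  have key : ∀ b, X.Tails S μ b → (D b ↔ D γ) := by
    rintro b hb
    obtain ⟨a, ha⟩ := hb.2
    rcases hγ.2 b hb.1 ((X.tgt_eq ha).symm.trans hy) with rfl | ⟨c, hc⟩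
    · rfl
    · obtain ⟨d, -, hd⟩ := X.assoc' hc ha
      exact (hD γ b ⟨hγ.1, d, hd⟩ hb ⟨c, hc⟩).symm
  exact hDb' ((key b' hb').2 ((key b hb).1 hDb))

/-- A profound element divisible by `γ` on the left but by nothing else does not exist. -/
theorem Tight.exists_other_irred {S : Finset M} (hT : X.Tight S) {γ μ : M} (hμ : X.Profound S μ)
    (hγS : γ ∈ S) (hγ : X.Pre γ μ) : ∃ α, X.Irred S α ∧ α ≠ γ ∧ X.Pre α μ := by
  obtain ⟨b₀, hb₀⟩ := hγ
  obtain ⟨D, hD, b, b', hb, hb', hDb, hDb'⟩ := hT.splits_tails μ hμ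
  by_contra! hno
  have hT₀ : X.Tails S μ b₀ := ⟨(hT.closed hb₀ hμ.1).1 hγS, γ, hb₀⟩
  have key : ∀ b, X.Tails S μ b → (D b ↔ D b₀) := by
    rintro b hb
    obtain ⟨a, ha⟩ := hb.2
    obtain ⟨α, hα, h⟩ := exists_irred_pre (X := X) ((hT.closed ha hμ.1).2 hb.1)
    have hαγ : α = γ := by
      by_contra hne
      refine hno α hα hne ?_
      rcases h with rfl | h
      exacts [⟨b, ha⟩, h.trans ⟨b, ha⟩]
    subst hαγ
    rcases h with rfl | ⟨c, hc⟩
    · rw [X.cancel_left ha hb₀]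
    · obtain ⟨d, hd, hd'⟩ := X.assoc hc ha
      obtain rfl := X.cancel_left hd' hb₀
      exact hD b d hb hT₀ ⟨c, hd⟩
  exact hDb' ((key b' hb').2 ((key b hb).1 hDb))

/-- An irreducible element that is not low would be profound. Its terminal factors would form a
disconnected and hence non-empty graph, against irreducibility. -/
theorem Tight.low_of_irred {S : Finset M} (hT : X.Tight S) {α : M} (hα : X.Irred S α) :
    X.Low α := by
  by_contra hlow
  have hμ : X.Profound S α :=
    ⟨hα.1, fun b c _ h => hlow ⟨b, c, .inl h⟩, fun b c _ h => hlow ⟨b, c, .inr h⟩⟩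
  obtain ⟨-, -, b, -, ⟨hb, a, ha⟩, -⟩ := hT.splits_tails α hμ
  exact hα.2 a ((hT.closed ha hα.1).2 hb) b hb ha

/-- Each zigzag in a tight set that can leave a source can also leave the next sink. -/
theorem ZigzagFree.exists_step (hZ : X.ZigzagFree) {S : Finset M} (hT : X.Tight S) {ρ γ : M}
    (hρ : ρ ∈ S) (hγ : X.Irred S γ) (hsrc : X.src γ = X.src ρ) (hne : γ ≠ ρ)
    (hpre : ¬ X.Pre γ ρ) :
    ∃ ρ' ∈ S, X.Low ρ' ∧ X.SrcInc ρ ρ' ∧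
      ∃ ε, X.Irred S ε ∧ X.tgt ε = X.tgt ρ' ∧ ε ≠ ρ' ∧ ¬ ∃ a, X.Comp a ε ρ' := by
  classical
  by_contra hcon
  -- Under the negated claim, whatever low `ρ'` is reached from `ρ`, every irreducible element
  -- entering its target already ends `ρ'`.
  have stuck : ∀ ρ' ∈ S, X.Low ρ' → X.SrcInc ρ ρ' → ∀ ε, X.Irred S ε → X.tgt ε = X.tgt ρ' →
      ε = ρ' ∨ ∃ a, X.Comp a ε ρ' := by
    intro ρ' h1 h2 h3 ε h4 h5
    by_contra! h6
    exact hcon ⟨ρ', h1, h2, h3, ε, h4, h5, h6.1, fun ⟨a, ha⟩ => h6.2 a ha⟩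
  have hS : X.Closed S := hT.closed
  -- For irreducible `ρ' = α` being stuck means that `α` is the only way to enter its target, so
  -- tightness splits the heads of `α`.
  have hentry : ∀ α, X.Irred S α → X.SrcInc ρ α → X.OnlyEntry S α := by
    refine fun α hα hinc => ⟨hα.1, fun m hm hmt => ?_⟩
    obtain ⟨ε, hε, h⟩ := exists_irred_tail (X := X) hm
    have hεt : X.tgt ε = X.tgt α := by
      rcases h with rfl | ⟨a, ha⟩
      exacts [hmt, (X.tgt_eq ha).symm.trans hmt]
    rcases stuck α hα.1 (hT.low_of_irred hα) hinc ε hε hεt with rfl | ⟨a, ha⟩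
    · exact h.imp Eq.symm id
    · exact absurd ha (hα.2 a ((hS ha hα.1).2 hε.1) ε hε.1)
  have hirr : ∀ α, X.Irred S α → ∀ m ∈ S, ¬ X.Pre m α := by
    rintro α hα m hm ⟨c, hc⟩
    exact hα.2 m hm c ((hS hc hα.1).1 hm) hc
  -- Here `N` is a union of components of the elements around `γ`, consists of elements incomparable
  -- with `ρ` and contains a multiple of `γ`. The descent finds another irreducible `α` in `N` and a
  -- strictly smaller such set for `α`.
  have descent : ∀ n, ∀ N : Finset M, N.card = n → ∀ γ, X.Irred S γ → X.OnlyEntry S γ →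
      X.src γ = X.src ρ → (∀ m ∈ N, X.Around S γ m) →
      (∀ m ∈ N, ∀ m', X.Around S γ m' → (X.Pre m m' ∨ X.Pre m' m) → m' ∈ N) →
      (∀ m ∈ N, X.SrcInc ρ m) → (∃ m ∈ N, X.Pre γ m) → False := by
    intro n
    induction n using Nat.strong_induction_on with
    | _ n ih =>
      rintro N rfl γ hγ hγe hsrc hA hcl hinc ⟨m, hm, hγm⟩
      obtain ⟨m', hm', hmm', μ, hμ, hμm⟩ := hS.exists_profound (hA m hm).1
      have htm : X.tgt m' ≠ X.tgt γ := by
        have := hT.tgt_ne_of_profound hγe hμ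
        rcases hμm with rfl | ⟨a, ha⟩
        · exact this
        · rwa [X.tgt_eq ha] at this
      have hγm' : X.Pre γ m' := by
        rcases hmm' with rfl | h
        exacts [hγm, hγm.trans h]
      have hAm' : X.Around S γ m' := ⟨hm', hγm'.src_eq, hγm'.ne.symm, fun _ => htm⟩
      have hm'N : m' ∈ N := by
        rcases hmm' with rfl | h
        exacts [hm, hcl m hm m' hAm' (.inl h)]
      -- If `m'` were a proper terminal factor of `μ`, it would be low, hence stuck. All irreducible
      -- terminal factors of `μ` would then end `m'`, and the graph of terminal factors would be
      -- connected.
      have hμm' : μ = m' := by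
        rcases hμm with rfl | ⟨a, ha⟩
        · rfl
        exfalso
        obtain ⟨D, hD, b, b', hb, hb', hDb, hDb'⟩ := hT.splits_tails μ hμ
        have hTm' : X.Tails S μ m' := ⟨hm', a, ha⟩
        have key : ∀ b, X.Tails S μ b → (D b ↔ D m') := by
          rintro b hb
          obtain ⟨d, hd⟩ := hb.2
          obtain ⟨ε, hε, h⟩ := exists_irred_tail (X := X) hb.1
          have hTε : X.Tails S μ ε := by
            rcases h with rfl | ⟨c, hc⟩
            · exact hb
            · obtain ⟨e, -, he⟩ := X.assoc' hc hd
              exact ⟨hε.1, e, he⟩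
          have h1 : D ε ↔ D b := by
            rcases h with rfl | h
            exacts [Iff.rfl, hD ε b hTε hb h]
          have hεt : X.tgt ε = X.tgt m' := by
            obtain ⟨e, he⟩ := hTε.2
            rw [← X.tgt_eq he, X.tgt_eq ha]
          have h2 : D ε ↔ D m' := by
            rcases stuck m' hm' ⟨a, μ, .inr ha⟩ (hinc m' hm'N) ε hε hεt with rfl | h
            exacts [Iff.rfl, hD ε m' hTε hTm' h]
          exact h1.symm.trans h2
        exact hDb' ((key b' hb').2 ((key b hb).1 hDb))
      subst hμm'
      obtain ⟨α, hα, hαγ, hαμ⟩ := hT.exists_other_irred hμ hγ.1 hγm'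
      have hsα : X.src α = X.src γ := hαμ.src_eq.symm.trans hγm'.src_eq
      have htα : X.tgt α ≠ X.tgt γ := by
        intro ht
        rcases hγe.2 α hα.1 ht with h | ⟨a, ha⟩
        · exact hαγ h
        · exact hα.2 a ((hS ha hα.1).2 hγ.1) γ hγ.1 ha
      have hαN : α ∈ N := hcl μ hm'N α ⟨hα.1, hsα, hαγ, fun _ => htα⟩ (.inr hαμ)
      have hαe := hentry α hα (hinc α hαN)
      obtain ⟨φ, hφ, c, c', hc, hc', hαc, hαc', hcc'⟩ :=
        hZ.exists_separator hS hα (hT.splits_heads α hαe)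
      -- Of two multiples of `α` separated by `φ`, at least one is also separated from `γ`. Its
      -- component around `α` avoids `γ` and hence stays inside `N`, but it no longer contains `α`.
      obtain ⟨c, hc, hαc, hcγ⟩ : ∃ c, X.Around S α c ∧ X.Pre α c ∧ φ c ≠ φ γ := by
        by_cases h : φ c = φ γ
        · exact ⟨c', hc', hαc', fun h' => hcc' (h.trans h'.symm)⟩
        · exact ⟨c, hc, hαc, h⟩
      have hγA : X.Around S α γ := ⟨hγ.1, hsα.symm, hαγ.symm, fun _ => htα.symm⟩
      -- The only elements around `α` that are not around `γ` are `γ` itself and, if `γ` is a loop,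
      -- its powers; on all of these `φ` has the value `φ γ`.
      have htrans : ∀ m, X.Around S α m → φ m ≠ φ γ → X.Around S γ m := by
        refine fun m hm hmγ => ⟨hm.1, hm.2.1.trans hsα, fun h => hmγ (by rw [h]), fun hl ht => ?_⟩
        rcases hγe.eq_or_pre_of_loop hS hl hm.1 ht with h | h
        · exact hmγ (by rw [h])
        · exact hmγ (hφ γ m hγA hm h).symm
      refine ih _ ?_ (N.filter fun m => X.Around S α m ∧ φ m = φ c) rfl α hα hαe
        (hsα.trans hsrc) (fun m hm => (Finset.mem_filter.1 hm).2.1) ?_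
        (fun m hm => hinc m (Finset.mem_filter.1 hm).1) ⟨c, Finset.mem_filter.2 ⟨?_, hc, rfl⟩, hαc⟩
      · refine Finset.card_lt_card (Finset.ssubset_iff_of_subset (Finset.filter_subset _ _) |>.2
          ⟨α, hαN, fun h => (Finset.mem_filter.1 h).2.1.2.2.1 rfl⟩)
      · intro m hm m' hm' hmm'
        rw [Finset.mem_filter] at hm
        have e : φ m' = φ c := by
          rw [← hm.2.2]
          rcases hmm' with h | h
          exacts [(hφ m m' hm.2.1 hm' h).symm, hφ m' m hm' hm.2.1 h]
        exact Finset.mem_filter.2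
          ⟨hcl m hm.1 m' (htrans m' hm' (by rwa [e])) hmm', hm', e⟩
      · exact hcl α hαN c (htrans c hc hcγ) (.inl hαc)
  have hincγ : X.SrcInc ρ γ := ⟨hsrc.symm, hne.symm, hirr γ hγ ρ hρ, hpre⟩
  have hγe := hentry γ hγ hincγ
  obtain ⟨φ, hφ, c, c', hc, hc', hγc, hγc', hcc'⟩ :=
    hZ.exists_separator hS hγ (hT.splits_heads γ hγe)
  -- The descent starts from a component that `φ` separates from `ρ`; this makes all its elements
  -- incomparable with `ρ`.
  obtain ⟨c, hc, hγc, hcρ⟩ : ∃ c, X.Around S γ c ∧ X.Pre γ c ∧ φ c ≠ φ ρ := by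
    by_cases h : φ c = φ ρ
    · exact ⟨c', hc', hγc', fun h' => hcc' (h.trans h'.symm)⟩
    · exact ⟨c, hc, hγc, h⟩
  have hρA : X.Around S γ ρ := by
    refine ⟨hρ, hsrc.symm, hne.symm, fun hl ht => ?_⟩
    exact (hγe.eq_or_pre_of_loop hS hl hρ ht).elim (fun h => hne h.symm) hpre
  refine descent _ (S.filter fun m => X.Around S γ m ∧ φ m = φ c) rfl γ hγ hγe hsrc
    (fun m hm => (Finset.mem_filter.1 hm).2.1) ?_ ?_ ⟨c, Finset.mem_filter.2 ⟨hc.1, hc, rfl⟩, hγc⟩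
  · intro m hm m' hm' hmm'
    rw [Finset.mem_filter] at hm ⊢
    refine ⟨hm'.1, hm', ?_⟩
    rw [← hm.2.2]
    rcases hmm' with h | h
    exacts [(hφ m m' hm.2.1 hm' h).symm, hφ m' m hm' hm.2.1 h]
  · intro m hm
    rw [Finset.mem_filter] at hm
    refine ⟨hsrc.symm.trans hm.2.1.2.1.symm, ?_, fun h => ?_, fun h => ?_⟩
    · rintro rfl
      exact hcρ hm.2.2.symm
    · exact hcρ (hm.2.2.symm.trans (hφ ρ m hρA hm.2.1 h).symm)
    · exact hcρ (hm.2.2.symm.trans (hφ m ρ hm.2.1 hρA h))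

/-- A zigzag-free system has no non-empty set that is tight on both sides. -/
theorem ZigzagFree.not_tight (hZ : X.ZigzagFree) {S : Finset M} (hS : S.Nonempty)
    (hT : X.Tight S) (hT' : X.op.Tight S) : False := by
  obtain ⟨m, hm⟩ := hS
  obtain ⟨-, -, -, μ, hμ, -⟩ := Closed.exists_profound (X := X) hT.closed hm
  obtain ⟨γ, hγ, h⟩ := exists_irred_pre (X := X) hμ.1
  have hγμ : X.Pre γ μ := by
    refine h.resolve_left ?_
    rintro rfl
    obtain ⟨-, -, b, -, ⟨hb, a, ha⟩, -⟩ := hT.splits_tails γ hμ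
    exact hγ.2 a ((hT.closed ha hγ.1).2 hb) b hb ha
  obtain ⟨α, hα, hαγ, hαμ⟩ := hT.exists_other_irred hμ hγ.1 hγμ
  let σ := {s : M × M // s.1 ∈ S ∧ X.Low s.1 ∧ X.Irred S s.2 ∧ X.src s.2 = X.src s.1 ∧
    s.2 ≠ s.1 ∧ ¬ X.Pre s.2 s.1}
  have : Nonempty σ := ⟨⟨(α, γ), hα.1, hT.low_of_irred hα, hγ,
    hγμ.src_eq.symm.trans hαμ.src_eq, hαγ.symm, fun ⟨c, hc⟩ =>
      hα.2 γ hγ.1 c ((hT.closed hc hα.1).1 hγ.1) hc⟩⟩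
  -- The zigzag begins by leaving a source, so it is a zigzag of the opposite system. Each round
  -- makes one step in the system and one in its opposite.
  refine hZ.op.false_of_step (σ := σ) (fun s => s.1.1) (fun s => op_low.2 s.2.2.1) ?_
  rintro ⟨⟨ρ, γ⟩, h1, h2, h3, h4, h5, h6⟩
  obtain ⟨ρ', m1, l1, i1, ε, hε, tε, nε, pε⟩ := hZ.exists_step hT h1 h3 h4 h5 h6
  obtain ⟨ρ'', m2, l2, i2, δ, hδ, tδ, nδ, pδ⟩ :=
    hZ.op.exists_step hT' m1 (irred_op.2 hε) tε nε pε
  exact ⟨⟨(ρ'', δ), m2, op_low.1 l2, irred_op.1 hδ, tδ, nδ, pδ⟩, ρ', op_low.2 l1, i1, i2⟩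

/-- If one of the graphs were connected, a primitive on a smaller closed set would extend to `S`. -/
theorem Tight.of_minimal [DecidableEq M] [DecidableEq O] (hZ : X.ZigzagFree) {S : Finset M}
    (hS : X.Closed S) {f : M → M → A} (hf : X.IsCocycle f) (hex : ¬ X.ExactOn f S)
    (hmin : ∀ S' ⊂ S, X.Closed S' → X.ExactOn f S') : X.Tight S where
  closed := hS
  splits_tails μ hμ := by
    by_contra hs
    exact hex (ExactOn.insert_profound hS hf hμ hs
      (hmin _ (Finset.erase_ssubset hμ.1) (hS.erase_profound hμ)))
  splits_heads γ hγ := by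
    by_contra hs
    refine hex (hZ.exactOn_of_filter hS hf hγ hs (hmin _ ?_ (Closed.filter_object hS _)))
    exact Finset.filter_ssubset.2 ⟨γ, hγ.1, fun h => h.2 rfl⟩

/-- Cocycles of zigzag-free systems are exact on finite closed sets. -/
theorem ZigzagFree.exactOn (hZ : X.ZigzagFree) {f : M → M → A} (hf : X.IsCocycle f)
    (S : Finset M) (hS : X.Closed S) : X.ExactOn f S := by
  classical
  induction S using Finset.strongInduction with
  | _ S ih =>
    by_contra hex
    refine hZ.not_tight (S := S) ?_ (Tight.of_minimal hZ hS hf hex ih)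
      (Tight.of_minimal hZ.op (Closed.op hS) hf.op (fun h => hex (exactOn_op h))
        fun S' hS' hc => exactOn_op (X := X.op) (ih S' hS' (Closed.op hc)))
    rw [Finset.nonempty_iff_ne_empty]
    rintro rfl
    exact hex ⟨0, fun h => absurd h (Finset.notMem_empty _)⟩

end CancelSystem

end RayCat

/-! ### From finite sets to the whole system by divisibility -/

namespace RayCat

namespace CancelSystem

variable {M O : Type*} {X : CancelSystem M O} {A : Type*} [AddCommGroup A]

/-- A function on triples with values in a divisible group is a coboundary if it is a coboundary
on finite sets. -/
theorem exists_primitive [DivisibleBy A ℤ] {f : M → M → A}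
    (h : ∀ T : Finset M, ∃ S : Finset M, T ⊆ S ∧ X.ExactOn f S) :
    ∃ g : M → A, ∀ {a b c}, X.Comp a b c → f a b = g a + g b - g c := by
  classical
  let τ := {t : M × M × M // X.Comp t.1 t.2.1 t.2.2}
  let Φ : (τ →₀ ℤ) →ₗ[ℤ] (M →₀ ℤ) := Finsupp.linearCombination ℤ fun t =>
    Finsupp.single t.1.1 1 + Finsupp.single t.1.2.1 1 - Finsupp.single t.1.2.2 1
  let F : (τ →₀ ℤ) →ₗ[ℤ] A := Finsupp.linearCombination ℤ fun t => f t.1.1 t.1.2.1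
  -- A primitive is an extension of `F` along the boundary map `Φ`. An integral relation between
  -- boundaries involves finitely many elements, so a primitive on a finite set shows that `F`
  -- respects it.
  have hker : LinearMap.ker Φ ≤ LinearMap.ker F := by
    intro x hx
    obtain ⟨S, hTS, g, hg⟩ := h (x.support.biUnion fun t => {t.1.1, t.1.2.1, t.1.2.2})
    let G : (M →₀ ℤ) →ₗ[ℤ] A := Finsupp.linearCombination ℤ g
    have hFG : F x = G (Φ x) := by
      simp only [F, Φ, Finsupp.linearCombination_apply, Finsupp.sum, map_sum, map_smul]
      refine Finset.sum_congr rfl fun t ht => ?_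
      have hmem : ∀ m ∈ ({t.1.1, t.1.2.1, t.1.2.2} : Finset M), m ∈ S := fun m hm =>
        hTS (Finset.mem_biUnion.2 ⟨t, ht, hm⟩)
      rw [hg (hmem _ (by simp)) (hmem _ (by simp)) (hmem _ (by simp)) t.2]
      simp [G]
    rw [LinearMap.mem_ker] at hx ⊢
    rw [hFG, hx, map_zero]
  -- So `F` factors through the image of `Φ`, and divisible groups are injective.
  obtain ⟨G, hG⟩ := (Module.Baer.of_divisible A).extension_property
    (LinearMap.ker Φ |>.liftQ Φ le_rfl) (by
      rw [← LinearMap.ker_eq_bot, Submodule.ker_liftQ_eq_bot]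
      exact le_rfl) (LinearMap.ker Φ |>.liftQ F hker)
  refine ⟨fun m => G (Finsupp.single m 1), fun {a b c} hc => ?_⟩
  have := LinearMap.congr_fun hG (Submodule.Quotient.mk (Finsupp.single (⟨(a, b, c), hc⟩ : τ) 1))
  simpa [Φ, F] using this.symm

/-- Over a divisible group, cocycles on a zigzag-free system that is exhausted by finite closed
sets are coboundaries. -/
theorem ZigzagFree.exists_primitive [DivisibleBy A ℤ] (hZ : X.ZigzagFree)
    (hX : ∀ T : Finset M, ∃ S : Finset M, T ⊆ S ∧ X.Closed S) {f : M → M → A}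
    (hf : X.IsCocycle f) :
    ∃ g : M → A, ∀ {a b c}, X.Comp a b c → f a b = g a + g b - g c :=
  CancelSystem.exists_primitive fun T =>
    let ⟨S, hTS, hS⟩ := hX T
    ⟨S, hTS, hZ.exactOn hf S hS⟩

end CancelSystem

/-- The units of an algebraically closed field form a divisible group. -/
noncomputable instance divisibleByUnits (k : Type*) [Field k] [IsAlgClosed k] :
    DivisibleBy (Additive kˣ) ℤ :=
  letI : DivisibleBy (Additive kˣ) ℕ := divisibleByOfSMulRightSurj _ _ fun {n} hn x => by
    obtain ⟨z, hz⟩ := IsAlgClosed.exists_pow_nat_eq (x.toMul : k) (Nat.pos_of_ne_zero hn)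
    have hz0 : z ≠ 0 := by
      rintro rfl
      rw [zero_pow hn] at hz
      exact x.toMul.ne_zero hz.symm
    exact ⟨Additive.ofMul (Units.mk0 z hz0), Additive.toMul.injective (Units.ext (by simpa using hz))⟩
  AddGroup.divisibleByIntOfDivisibleByNat _

end RayCat

/-! ### The cancellation system of a ray-category -/

namespace RayCat

section

variable {P : Type u} [Category.{v} P] [HasZeroMorphisms P]

/-- A nilpotent isomorphism is zero. -/
theorem IsBaseCategory.eq_id_of_isIso (hP : IsBaseCategory P) {x : P} (f : x ⟶ x) [IsIso f]
    (h0 : f ≠ 0) : f = 𝟙 x := by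
  by_contra hne
  obtain ⟨n, hn⟩ := hP.nilpotent x f hne
  let e : End x := f
  have key : ∀ n : ℕ, e ^ n = (0 : x ⟶ x) → f = 0 := by
    intro n
    induction n with
    | zero =>
      intro h
      have h' : 𝟙 x = (0 : x ⟶ x) := h
      rw [← Category.comp_id f, h', comp_zero]
    | succ n ih =>
      intro h
      rw [pow_succ, End.mul_def] at h
      exact ih (by rw [← cancel_epi f, comp_zero]; exact h)
  exact h0 (key n hn)

/-- By skeletality `f ≫ g` is an identity. If `g ≫ f` were not, it would be nilpotent, while
composing `f` with its powers gives back `f`; so `f` would vanish. -/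
theorem IsBaseCategory.isIso_of_comp (hP : IsBaseCategory P) {x y z : P} (f : x ⟶ y) (g : y ⟶ z)
    [IsIso (f ≫ g)] (h0 : f ≫ g ≠ 0) : IsIso f ∧ IsIso g := by
  obtain rfl := hP.skeletal x z ⟨asIso (f ≫ g)⟩
  have h1 : f ≫ g = 𝟙 x := hP.eq_id_of_isIso _ h0
  by_cases he : g ≫ f = 𝟙 y
  · exact ⟨⟨g, h1, he⟩, ⟨f, he, h1⟩⟩
  · obtain ⟨n, hn⟩ := hP.nilpotent y (g ≫ f) he
    let e : End y := g ≫ f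
    have key : ∀ n : ℕ, f ≫ (e ^ n : End y) = f := by
      intro n
      induction n with
      | zero => exact Category.comp_id f
      | succ n ih =>
        rw [pow_succ, End.mul_def, Category.assoc, ← Category.assoc f, h1, Category.id_comp, ih]
    have h : f ≫ (0 : y ⟶ y) = f := hn ▸ key n
    rw [comp_zero] at h
    exact absurd (by rw [← h, zero_comp]) h0

variable (P) in
/-- The non-zero non-invertible morphisms. -/
structure Elt where
  src : P
  tgt : P
  hom : src ⟶ tgt
  ne_zero : hom ≠ 0
  not_iso : ¬ IsIso hom

/-- Non-zero compositions of non-invertible morphisms. -/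
inductive Elt.Comp : Elt P → Elt P → Elt P → Prop
  | mk {x y z : P} (f : x ⟶ y) (g : y ⟶ z) (k : x ⟶ z) (h : f ≫ g = k) (hf hf' hg hg' hk hk') :
      Comp ⟨x, y, f, hf, hf'⟩ ⟨y, z, g, hg, hg'⟩ ⟨x, z, k, hk, hk'⟩

/-- The system of non-zero non-invertible morphisms of a ray-category. -/
def IsRayCategory.system (hP : IsRayCategory P) : CancelSystem (Elt P) P where
  src := Elt.src
  tgt := Elt.tgt
  Comp := Elt.Comp
  src_eq := by rintro _ _ _ ⟨⟩; rfl
  tgt_eq := by rintro _ _ _ ⟨⟩; rfl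
  mid_eq := by rintro _ _ _ ⟨⟩; rfl
  unique := by
    rintro _ _ _ _ ⟨f, g, k, h⟩ h'
    cases h' with
    | mk f g k' h' => subst h h'; rfl
  cancel_left := by
    rintro _ _ _ _ ⟨f, g, k, h, _, _, _, _, hk, _⟩ h'
    cases h' with
    | mk f g' k h' =>
      obtain rfl := hP.cancel_right f g g' (h.trans h'.symm) (h ▸ hk)
      rfl
  cancel_right := by
    rintro _ _ _ _ ⟨f, g, k, h, _, _, _, _, hk, _⟩ h'
    cases h' with
    | mk f' g k h' =>
      obtain rfl := hP.cancel_left f f' g (h.trans h'.symm) (h ▸ hk)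
      rfl
  assoc := by
    rintro _ _ ⟨_, _, r, hr, hr'⟩ _ _ ⟨f, g, k, h, hf, hf', hg, hg', hk, hk'⟩ h'
    cases h' with
    | mk _ _ l h' _ _ _ _ hl hl' =>
      subst h h'
      have h0 : g ≫ r ≠ 0 := fun h0 => hl (by rw [Category.assoc, h0, comp_zero])
      exact ⟨⟨_, _, g ≫ r, h0, fun _ => hg' (hP.isIso_of_comp g r h0).1⟩, ⟨_, _, _, rfl, _, _, _, _, _, _⟩,
        ⟨_, _, _, (Category.assoc _ _ _).symm, _, _, _, _, _, _⟩⟩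
  assoc' := by
    rintro ⟨_, _, r, hr, hr'⟩ _ _ _ _ ⟨f, g, k, h, hf, hf', hg, hg', hk, hk'⟩ h'
    cases h' with
    | mk _ _ l h' _ _ _ _ hl hl' =>
      subst h h'
      have h0 : r ≫ f ≠ 0 := fun h0 => hl (by rw [← Category.assoc, h0, zero_comp])
      exact ⟨⟨_, _, r ≫ f, h0, fun _ => hf' (hP.isIso_of_comp r f h0).2⟩, ⟨_, _, _, rfl, _, _, _, _, _, _⟩,
        ⟨_, _, _, Category.assoc _ _ _, _, _, _, _, _, _⟩⟩
  ne_left := by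
    rintro _ _ _ ⟨f, g, k, h, hf, hf', hg, hg', hk, hk'⟩ h'
    injection h' with _ h1 h2
    subst h1
    obtain rfl := eq_of_heq h2
    obtain rfl := hP.cancel_right k g (𝟙 _) (by simp [h]) (by rwa [h])
    exact hg' inferInstance
  ne_right := by
    rintro _ _ _ ⟨f, g, k, h, hf, hf', hg, hg', hk, hk'⟩ h'
    injection h' with h1 _ h2
    subst h1
    obtain rfl := eq_of_heq h2
    obtain rfl := hP.cancel_left f (𝟙 _) k (by simp [h]) (by rwa [h])
    exact hf' inferInstance

theorem IsRayCategory.comp_mk (hP : IsRayCategory P) {x y z : P} (f : x ⟶ y) (g : y ⟶ z)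
    (hf : ¬ IsIso f) (hg : ¬ IsIso g) (h0 : f ≫ g ≠ 0) :
    hP.system.Comp ⟨x, y, f, fun h => h0 (by rw [h, zero_comp]), hf⟩
      ⟨y, z, g, fun h => h0 (by rw [h, comp_zero]), hg⟩
      ⟨x, z, f ≫ g, h0, fun _ => hf (hP.isIso_of_comp f g h0).1⟩ :=
  ⟨f, g, _, rfl, _, _, _, _, _, _⟩

theorem IsBaseCategory.finite_src (hP : IsBaseCategory P) (x : P) :
    {a : Elt P | a.src = x}.Finite := by
  have : Finite {s : Σ y : P, (x ⟶ y) // s.2 ≠ 0 ∧ ¬ IsIso s.2} :=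
    ((hP.finite_start x).subset fun s (hs : s.2 ≠ 0 ∧ ¬ IsIso s.2) => hs.1).to_subtype
  refine (Set.finite_range fun s : {s : Σ y : P, (x ⟶ y) // s.2 ≠ 0 ∧ ¬ IsIso s.2} =>
    (⟨x, s.1.1, s.1.2, s.2.1, s.2.2⟩ : Elt P)).subset ?_
  rintro ⟨_, y, f, h0, hi⟩ rfl
  exact ⟨⟨⟨y, f⟩, h0, hi⟩, rfl⟩

theorem IsBaseCategory.finite_tgt (hP : IsBaseCategory P) (y : P) :
    {a : Elt P | a.tgt = y}.Finite := by
  have : Finite {s : Σ x : P, (x ⟶ y) // s.2 ≠ 0 ∧ ¬ IsIso s.2} :=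
    ((hP.finite_end y).subset fun s (hs : s.2 ≠ 0 ∧ ¬ IsIso s.2) => hs.1).to_subtype
  refine (Set.finite_range fun s : {s : Σ x : P, (x ⟶ y) // s.2 ≠ 0 ∧ ¬ IsIso s.2} =>
    (⟨s.1.1, y, s.1.2, s.2.1, s.2.2⟩ : Elt P)).subset ?_
  rintro ⟨x, _, f, h0, hi⟩ rfl
  exact ⟨⟨⟨x, f⟩, h0, hi⟩, rfl⟩

/-- All elements between the finitely many objects touched by `T`: the corresponding full
subcategory is finite because only finitely many non-zero morphisms start at an object. -/
theorem IsRayCategory.exists_closed (hP : IsRayCategory P) (T : Finset (Elt P)) :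
    ∃ S : Finset (Elt P), T ⊆ S ∧ hP.system.Closed S := by
  classical
  let U : Finset P := T.image Elt.src ∪ T.image Elt.tgt
  have hfin : {a : Elt P | a.src ∈ U ∧ a.tgt ∈ U}.Finite := by
    refine (U.finite_toSet.biUnion fun x _ => hP.finite_src x).subset ?_
    rintro a ⟨ha, -⟩
    simpa using ha
  refine ⟨hfin.toFinset, fun a ha => ?_, ?_⟩
  · rw [Set.Finite.mem_toFinset]
    exact ⟨Finset.mem_union_left _ (Finset.mem_image_of_mem _ ha),
      Finset.mem_union_right _ (Finset.mem_image_of_mem _ ha)⟩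
  · intro a b c h hc
    rw [Set.Finite.mem_toFinset] at hc ⊢
    rw [Set.Finite.mem_toFinset]
    obtain ⟨h1, h2⟩ := hc
    obtain ⟨⟩ := h
    exact ⟨fun h => ⟨h.2, h2⟩, fun h => ⟨h1, h.1⟩⟩

theorem CancelSystem.wellFounded_of_finite {M O : Type*} (X : CancelSystem M O)
    (h : ∀ x, {a : M | X.src a = x}.Finite) : WellFounded X.Pre := by
  have hfin : ∀ b, {a : M | X.Pre a b}.Finite := fun b =>
    (h (X.src b)).subset fun a ha => ha.src_eq.symm
  refine Subrelation.wf (fun {a b} hab => ?_)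
    (InvImage.wf (fun b : M => {a : M | X.Pre a b}.ncard) wellFounded_lt)
  refine Set.ncard_lt_ncard ⟨fun c hc => hc.trans hab, fun hle => ?_⟩ (hfin b)
  exact CancelSystem.not_pre_self a (hle hab)

theorem IsRayCategory.exists_irred_left (hP : IsRayCategory P) (a : Elt P) :
    ∃ (z : P) (α : a.src ⟶ z) (h : z ⟶ a.tgt), IsIrred α ∧ α ≫ h = a.hom := by
  induction a using (hP.system.wellFounded_of_finite hP.finite_src).induction with
  | _ a ih =>
    by_cases ha : IsIrred a.hom
    · exact ⟨_, a.hom, 𝟙 _, ha, Category.comp_id _⟩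
    · have : ∃ (z : P) (g : a.src ⟶ z) (h : z ⟶ a.tgt), g ≫ h = a.hom ∧ ¬ IsIso g ∧ ¬ IsIso h := by
        by_contra hne
        push Not at hne
        exact ha ⟨a.ne_zero, a.not_iso, fun z g h e => or_iff_not_imp_left.2 (hne z g h e)⟩
      obtain ⟨z, g, h, e, hg, hh⟩ := this
      obtain ⟨x, y, f, h0, hi⟩ := a
      dsimp only at e g h
      subst e
      obtain ⟨w, α, r, hα, hr⟩ := ih _ ⟨_, hP.comp_mk g h hg hh h0⟩
      exact ⟨w, α, r ≫ h, hα, by rw [← Category.assoc, hr]⟩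

theorem IsRayCategory.exists_irred_right (hP : IsRayCategory P) (a : Elt P) :
    ∃ (z : P) (h : a.src ⟶ z) (α : z ⟶ a.tgt), IsIrred α ∧ h ≫ α = a.hom := by
  induction a using (hP.system.op.wellFounded_of_finite hP.finite_tgt).induction with
  | _ a ih =>
    by_cases ha : IsIrred a.hom
    · exact ⟨_, 𝟙 _, a.hom, ha, Category.id_comp _⟩
    · have : ∃ (z : P) (g : a.src ⟶ z) (h : z ⟶ a.tgt), g ≫ h = a.hom ∧ ¬ IsIso g ∧ ¬ IsIso h := by
        by_contra hne
        push Not at hne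
        exact ha ⟨a.ne_zero, a.not_iso, fun z g h e => or_iff_not_imp_left.2 (hne z g h e)⟩
      obtain ⟨z, g, h, e, hg, hh⟩ := this
      obtain ⟨x, y, f, h0, hi⟩ := a
      dsimp only at e g h
      subst e
      obtain ⟨w, r, α, hα, hr⟩ := ih _ ⟨_, hP.comp_mk g h hg hh h0⟩
      exact ⟨w, g ≫ r, α, hα, by rw [Category.assoc, hr]⟩

theorem IsRayCategory.not_isProfound (hP : IsRayCategory P) {a : Elt P} (ha : hP.system.Low a) :
    ¬ IsProfound a.hom := by
  rintro ⟨-, h1, h2⟩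
  obtain ⟨b, c, hc | hc⟩ := ha
  · obtain ⟨z, α, r, hα, hr⟩ := hP.exists_irred_left b
    obtain ⟨f, g, k, h, hf, hf', hg, hg', hk, hk'⟩ := hc
    have h1 := h1 z α hα
    dsimp only at hr h1
    exact hk (by rw [← h, ← hr, ← Category.assoc, h1, zero_comp])
  · obtain ⟨z, r, α, hα, hr⟩ := hP.exists_irred_right b
    obtain ⟨f, g, k, h, hf, hf', hg, hg', hk, hk'⟩ := hc
    have h2 := h2 z α hα
    dsimp only at hr h2
    exact hk (by rw [← h, ← hr, Category.assoc, h2, comp_zero])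

theorem IsRayCategory.sinkPair (hP : IsRayCategory P) {a b : Elt P} (h : hP.system.TgtInc a b) :
    SinkPair (Arrow.mk a.hom) (Arrow.mk b.hom) := by
  obtain ⟨x, z, f, hf, hf'⟩ := a
  obtain ⟨y, z', g, hg, hg'⟩ := b
  obtain ⟨h1, h2, h3, h4⟩ := h
  obtain rfl : z = z' := h1
  refine ⟨f, g, fun r hr => ?_, fun r hr => ?_⟩
  · by_cases hi : IsIso r
    · obtain rfl := hP.skeletal x y ⟨asIso r⟩
      obtain rfl := hP.eq_id_of_isIso r (by rintro rfl; exact hf (by rw [← hr, zero_comp]))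
      exact h2 (by simpa using hr.symm)
    · subst hr
      exact h4 ⟨_, hP.comp_mk r g hi hg' hf⟩
  · by_cases hi : IsIso r
    · obtain rfl := hP.skeletal y x ⟨asIso r⟩
      obtain rfl := hP.eq_id_of_isIso r (by rintro rfl; exact hg (by rw [← hr, zero_comp]))
      exact h2 (by simpa using hr)
    · subst hr
      exact h3 ⟨_, hP.comp_mk r f hi hf' hg⟩

theorem IsRayCategory.sourcePair (hP : IsRayCategory P) {a b : Elt P}
    (h : hP.system.SrcInc a b) : SourcePair (Arrow.mk a.hom) (Arrow.mk b.hom) := by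
  obtain ⟨z, x, f, hf, hf'⟩ := a
  obtain ⟨z', y, g, hg, hg'⟩ := b
  obtain ⟨h1, h2, h3, h4⟩ := h
  obtain rfl : z = z' := h1
  refine ⟨f, g, fun r hr => ?_, fun r hr => ?_⟩
  · by_cases hi : IsIso r
    · obtain rfl := hP.skeletal y x ⟨asIso r⟩
      obtain rfl := hP.eq_id_of_isIso r (by rintro rfl; exact hf (by rw [← hr, comp_zero]))
      exact h2 (by simpa using hr.symm)
    · subst hr
      exact h4 ⟨_, hP.comp_mk g r hg' hi hf⟩
  · by_cases hi : IsIso r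
    · obtain rfl := hP.skeletal x y ⟨asIso r⟩
      obtain rfl := hP.eq_id_of_isIso r (by rintro rfl; exact hg (by rw [← hr, comp_zero]))
      exact h2 (by simpa using hr)
    · subst hr
      exact h3 ⟨_, hP.comp_mk f r hf' hi hg⟩

/-- The initial segments of an infinite low zigzag are infinitely many low zigzags starting at the
same point. -/
theorem IsRayCategory.zigzagFree (hP : IsRayCategory P) (hz : IsWeaklyZigzagFinite P) :
    hP.system.ZigzagFree := by
  rintro ⟨r, hl, hr⟩
  let L : ℕ → List (Arrow P) := fun n => (List.range (n + 1)).map fun i => Arrow.mk (r i).hom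
  have hlen : ∀ n, (L n).length = n + 1 := by simp [L]
  have hget : ∀ n i (hi : i < (L n).length), (L n)[i] = Arrow.mk (r i).hom := by
    intro n i hi
    rw [List.getElem_map, List.getElem_range]
  have hL : ∀ n, IsLowZigzag (L n) ∧ StartsAt (r 0).src (L n) := by
    intro n
    have hne : L n ≠ [] := List.ne_nil_of_length_pos (by rw [hlen]; omega)
    refine ⟨⟨⟨hne, ?_, ?_, ?_⟩, ?_⟩, hne, ?_⟩
    · intro a ha
      obtain ⟨i, -, rfl⟩ := List.mem_map.1 ha
      exact ⟨(r i).ne_zero, (r i).not_iso⟩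
    · rintro i hi ⟨j, rfl⟩
      rw [hget, hget, ← two_mul]
      exact hP.sinkPair (hr j).1
    · rintro i hi ⟨j, rfl⟩
      rw [hget, hget]
      exact hP.sourcePair (hr j).2
    · intro a ha
      obtain ⟨i, -, rfl⟩ := List.mem_map.1 ha
      exact hP.not_isProfound (hl i)
    · rw [List.head_eq_getElem, hget]
      rfl
  refine Set.infinite_of_injective_forall_mem (f := L) (fun m n h => ?_) hL (hz (r 0).src)
  have := congrArg List.length h
  rw [hlen, hlen] at this
  omega

end

end RayCat

/-! ### Contour functions as cocycles -/

namespace RayCat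

section

variable {P : Type u} [Category.{v} P] [HasZeroMorphisms P]

theorem pathMor_comp {x y z : QuiverOf P} (p : Quiver.Path x y) (q : Quiver.Path y z) :
    pathMor (p.comp q) = pathMor p ≫ pathMor q := by
  simp only [pathMor, Prefunctor.mapPath_comp, composePath_comp]

theorem pathMor_cons {x y z : QuiverOf P} (p : Quiver.Path x y) (α : y ⟶ z) :
    pathMor (p.cons α) = pathMor p ≫ (QuiverOf.incl P).map α := rfl

theorem pathMor_toPath {x y : QuiverOf P} (α : x ⟶ y) :
    pathMor α.toPath = (QuiverOf.incl P).map α := Category.id_comp _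

/-- Each non-zero non-invertible morphism is given by a path. -/
theorem IsRayCategory.exists_path (hP : IsRayCategory P) (a : Elt P) :
    ∃ p : @Quiver.Path (QuiverOf P) _ a.src a.tgt, pathMor p = a.hom := by
  induction a using (hP.system.wellFounded_of_finite hP.finite_src).induction with
  | _ a ih =>
    obtain ⟨z, h, α, hα, e⟩ := hP.exists_irred_right a
    obtain ⟨x, y, f, h0, hi⟩ := a
    dsimp only at e h α
    subst e
    let α' : @Quiver.Hom (QuiverOf P) _ z y := ⟨α, hα⟩
    by_cases hh : IsIso h
    · obtain rfl := hP.skeletal x z ⟨asIso h⟩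
      obtain rfl := hP.eq_id_of_isIso h (by rintro rfl; exact h0 zero_comp)
      exact ⟨α'.toPath, rfl⟩
    · obtain ⟨p, hp⟩ := ih _ ⟨_, hP.comp_mk h α hh hα.2.1 h0⟩
      exact ⟨p.cons α', congrArg (· ≫ α) hp⟩

theorem IsRayCategory.not_isIso_pathMor (hP : IsRayCategory P) {x y z : QuiverOf P}
    (p : Quiver.Path x y) (α : y ⟶ z) (h0 : pathMor (p.cons α) ≠ 0) :
    ¬ IsIso (pathMor (p.cons α)) := fun hi =>
  have : IsIso (pathMor p ≫ (QuiverOf.incl P).map α) := hi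
  α.2.2.1 (hP.isIso_of_comp (pathMor p) ((QuiverOf.incl P).map α) h0).2

/-- A choice of paths for all non-zero non-invertible morphisms. -/
noncomputable def IsRayCategory.path (hP : IsRayCategory P) {x y : P} (f : x ⟶ y) (h0 : f ≠ 0)
    (hi : ¬ IsIso f) : @Quiver.Path (QuiverOf P) _ x y :=
  (hP.exists_path ⟨x, y, f, h0, hi⟩).choose

theorem IsRayCategory.pathMor_path (hP : IsRayCategory P) {x y : P} (f : x ⟶ y) (h0 : f ≠ 0)
    (hi : ¬ IsIso f) : pathMor (hP.path f h0 hi) = f :=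
  (hP.exists_path ⟨x, y, f, h0, hi⟩).choose_spec

theorem IsRayCategory.isContour_path_comp (hP : IsRayCategory P) {x y z : P} {f : x ⟶ y}
    {g : y ⟶ z} {k : x ⟶ z} (h : f ≫ g = k) (hf hf' hg hg' hk hk') :
    IsContour ((hP.path f hf hf').comp (hP.path g hg hg')) (hP.path k hk hk') := by
  have h' : pathMor ((hP.path f hf hf').comp (hP.path g hg hg')) = k :=
    (pathMor_comp _ _).trans ((congrArg₂ (fun (a : x ⟶ y) (b : y ⟶ z) => a ≫ b)
      (hP.pathMor_path f hf hf') (hP.pathMor_path g hg hg')).trans h)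
  exact ⟨h'.trans (hP.pathMor_path k hk hk').symm, fun h0 => hk (h'.symm.trans h0)⟩

variable {k : Type w} [Field k]

theorem IsContourFunction.self {c : Contour P → kˣ} (hc : IsContourFunction c) {x y : QuiverOf P}
    (p : Quiver.Path x y) (h : IsContour p p) : c ⟨p, p, h⟩ = 1 :=
  mul_eq_left.1 (hc.trans p p p h h h).symm

theorem IsContour.comp_left {x y z : QuiverOf P} {p q : Quiver.Path x y} (h : IsContour p q)
    (s : Quiver.Path y z) (h0 : pathMor (q.comp s) ≠ 0) : IsContour (p.comp s) (q.comp s) := by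
  have e : pathMor (p.comp s) = pathMor (q.comp s) := by rw [pathMor_comp, pathMor_comp, h.1]
  exact ⟨e, by rwa [e]⟩

theorem IsContour.comp_right {x y z : QuiverOf P} (t : Quiver.Path x y) {p q : Quiver.Path y z}
    (h : IsContour p q) (h0 : pathMor (t.comp q) ≠ 0) : IsContour (t.comp p) (t.comp q) := by
  have e : pathMor (t.comp p) = pathMor (t.comp q) := by rw [pathMor_comp, pathMor_comp, h.1]
  exact ⟨e, by rwa [e]⟩

theorem IsContourFunction.comp_trans {c : Contour P → kˣ} (hc : IsContourFunction c)
    {x y z : QuiverOf P} {p q : Quiver.Path x y} {r s : Quiver.Path y z} {t : Quiver.Path x z}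
    (h : IsContour p q) (h' : IsContour r s) (hqs : IsContour (q.comp s) t)
    (hpr : IsContour (p.comp r) t) :
    c ⟨p.comp r, t, hpr⟩ = c ⟨p, q, h⟩ * c ⟨r, s, h'⟩ * c ⟨q.comp s, t, hqs⟩ := by
  have h2 : IsContour (q.comp r) (q.comp s) := h'.comp_right q hqs.2
  have h1 : IsContour (p.comp r) (q.comp r) := h.comp_left r h2.2
  have h3 : IsContour (q.comp r) t := ⟨h2.1.trans hqs.1, h2.2⟩
  rw [hc.trans _ _ _ hpr h1 h3, hc.trans _ _ _ h3 h2 hqs,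
    hc.comp_left p q r h, hc.comp_right q r s h', mul_assoc]

/-- A path with invertible non-zero value has no arrows, since its last arrow would be invertible.
-/
theorem IsRayCategory.eq_of_isContour_of_isIso (hP : IsRayCategory P) {x y : QuiverOf P}
    {p q : Quiver.Path x y} (h : IsContour p q) (hi : IsIso (pathMor p)) : p = q := by
  have hq0 : pathMor q ≠ 0 := h.1 ▸ h.2
  have hqi : IsIso (pathMor q) := h.1 ▸ hi
  cases p with
  | cons p α => exact absurd hi (hP.not_isIso_pathMor p α h.2)
  | nil =>
    cases q with
    | nil => rfl
    | cons q α => exact absurd hqi (hP.not_isIso_pathMor q α hq0)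

/-- The values of a contour function on the contours that compare the chosen paths. -/
inductive IsRayCategory.Twist (hP : IsRayCategory P) (c : Contour P → kˣ) :
    Elt P → Elt P → kˣ → Prop
  | mk {x y z : P} (f : x ⟶ y) (g : y ⟶ z) (k : x ⟶ z) (h : f ≫ g = k) (hf hf' hg hg' hk hk') :
      Twist hP c ⟨x, y, f, hf, hf'⟩ ⟨y, z, g, hg, hg'⟩
        (c ⟨_, _, hP.isContour_path_comp h hf hf' hg hg' hk hk'⟩)

open Classical in
/-- The two-cocycle of a contour function. -/
noncomputable def IsRayCategory.cocycle (hP : IsRayCategory P) (c : Contour P → kˣ) (a b : Elt P) :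
    Additive kˣ :=
  if h : ∃ v, hP.Twist c a b v then Additive.ofMul h.choose else 0

/-- The two factors determine their composition, so `Twist` holds for a single value and the choice
in `cocycle` must return it. -/
theorem IsRayCategory.cocycle_mk (hP : IsRayCategory P) (c : Contour P → kˣ) {x y z : P}
    {f : x ⟶ y} {g : y ⟶ z} {k : x ⟶ z} (h : f ≫ g = k) (hf hf' hg hg' hk hk') :
    hP.cocycle c ⟨x, y, f, hf, hf'⟩ ⟨y, z, g, hg, hg'⟩ =
      Additive.ofMul (c ⟨_, _, hP.isContour_path_comp h hf hf' hg hg' hk hk'⟩) := by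
  have hex : ∃ v, hP.Twist c ⟨x, y, f, hf, hf'⟩ ⟨y, z, g, hg, hg'⟩ v :=
    ⟨_, f, g, k, h, _, _, _, _, hk, hk'⟩
  rw [IsRayCategory.cocycle, dif_pos hex]
  congr 1
  have hs := hex.choose_spec
  generalize hex.choose = v at hs
  cases hs with
  | mk _ _ k' h' => subst h h'; rfl

/-- Both sides compare the concatenation of three chosen paths with the chosen path of the triple
composition, through the two ways of bracketing. -/
theorem IsRayCategory.isCocycle (hP : IsRayCategory P) {c : Contour P → kˣ}
    (hc : IsContourFunction c) : hP.system.IsCocycle (hP.cocycle c) := by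
  intro a b r d e q h1 h2 h3 h4
  obtain ⟨f, g, fg, h1, hf, hf', hg, hg', hfg, hfg'⟩ := h1
  cases h2 with
  | mk _ r l h2 _ _ hr hr' hl hl' =>
  cases h3 with
  | mk _ _ gr h3 _ _ _ _ hgr hgr' =>
  cases h4 with
  | mk _ _ _ h4 =>
  rw [hP.cocycle_mk c h1 hf hf' hg hg' hfg hfg', hP.cocycle_mk c h2 hfg hfg' hr hr' hl hl',
    hP.cocycle_mk c h3 hg hg' hr hr' hgr hgr', hP.cocycle_mk c h4 hf hf' hgr hgr' hl hl',
    ← ofMul_mul, ← ofMul_mul]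
  congr 1
  have A := hP.isContour_path_comp h1 hf hf' hg hg' hfg hfg'
  have B := hP.isContour_path_comp h2 hfg hfg' hr hr' hl hl'
  have C := hP.isContour_path_comp h3 hg hg' hr hr' hgr hgr'
  have D := hP.isContour_path_comp h4 hf hf' hgr hgr' hl hl'
  have hfrg : IsContour (((hP.path f hf hf').comp (hP.path g hg hg')).comp (hP.path r hr hr'))
      ((hP.path fg hfg hfg').comp (hP.path r hr hr')) :=A.comp_left _ B.2
  have hfgr : IsContour ((hP.path f hf hf').comp ((hP.path g hg hg').comp (hP.path r hr hr')))
      ((hP.path f hf hf').comp (hP.path gr hgr hgr')) :=C.comp_right _ D.2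
  have hl' : IsContour (((hP.path f hf hf').comp (hP.path g hg hg')).comp (hP.path r hr hr'))
      (hP.path l hl hl') := ⟨hfrg.1.trans B.1, hfrg.2⟩
  have e1 := hc.trans _ _ _ hl' hfrg B
  rw [hc.comp_left _ _ _ A hfrg] at e1
  have e2 := hc.trans _ _ _ (⟨hfgr.1.trans D.1, hfgr.2⟩ : IsContour _ _) hfgr D
  rw [hc.comp_right _ _ _ C hfgr] at e2
  rw [← e1, ← e2]
  congr 2
  exact Quiver.Path.comp_assoc _ _ _

theorem IsRayCategory.isContour_path (hP : IsRayCategory P) {x y : QuiverOf P}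
    (p : Quiver.Path x y) (h0 : pathMor p ≠ 0) (hi : ¬ IsIso (pathMor p)) :
    IsContour p (hP.path (pathMor p) h0 hi) := ⟨(hP.pathMor_path _ h0 hi).symm, h0⟩

/-- A contour function whose cocycle is a coboundary is exact. -/
theorem IsRayCategory.exists_delta (hP : IsRayCategory P) {c : Contour P → kˣ}
    (hc : IsContourFunction c) {g : Elt P → Additive kˣ}
    (hg : ∀ {a b d}, hP.system.Comp a b d → hP.cocycle c a b = g a + g b - g d) :
    ∃ e : (x y : QuiverOf P) → (x ⟶ y) → kˣ, c = delta e := by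
  have hα : ∀ {x y : QuiverOf P} (α : x ⟶ y), IsContour α.toPath (hP.path α.1 α.2.1 α.2.2.1) :=
    fun α => ⟨(pathMor_toPath α).trans (hP.pathMor_path α.1 α.2.1 α.2.2.1).symm,
      fun h => α.2.1 ((pathMor_toPath α).symm.trans h)⟩
  -- The path chosen for an irreducible morphism is compared with the arrow itself; the second
  -- factor corrects for this choice.
  let e : (x y : QuiverOf P) → (x ⟶ y) → kˣ := fun x y α =>
    (g ⟨x, y, α.1, α.2.1, α.2.2.1⟩).toMul * c ⟨_, _, hα α⟩
  have key : ∀ {x y : QuiverOf P} (p : Quiver.Path x y)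
      (f : (QuiverOf.incl P).obj x ⟶ (QuiverOf.incl P).obj y) (h0 : f ≠ 0) (hi : ¬ IsIso f)
      (hpf : IsContour p (hP.path f h0 hi)), p.weight (fun {x y} a => e x y a) =
        (g ⟨x, y, f, h0, hi⟩).toMul * c ⟨p, hP.path f h0 hi, hpf⟩ := by
    intro x y p
    induction p with
    | nil =>
      intro f h0 hi hpf
      obtain rfl : 𝟙 _ = f := hpf.1.trans (hP.pathMor_path f h0 hi)
      exact absurd (IsIso.id _) hi
    | cons p α ih =>
      intro f h0 hi hpf
      obtain rfl : pathMor (p.cons α) = f := hpf.1.trans (hP.pathMor_path f h0 hi)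
      have hp0 : pathMor p ≠ 0 := fun h => h0 (by rw [pathMor_cons, h, zero_comp])
      rw [Quiver.Path.weight_cons]
      -- Identities are not elements of the system, so the empty initial path has to be treated
      -- apart.
      by_cases hpi : IsIso (pathMor p)
      · cases p with
        | cons p β => exact absurd hpi (hP.not_isIso_pathMor p β hp0)
        | nil =>
          have aux : ∀ (f : (QuiverOf.incl P).obj _ ⟶ (QuiverOf.incl P).obj _) (hf : f = α.1) (h0 : f ≠ 0) (hi : ¬ IsIso f)
              (hpf : IsContour α.toPath (hP.path f h0 hi)),
              e _ _ α = (g ⟨_, _, f, h0, hi⟩).toMul * c ⟨_, _, hpf⟩ := by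
            rintro f rfl h0 hi hpf
            rfl
          rw [Quiver.Path.weight_nil, one_mul]
          exact aux _ (Category.id_comp _) h0 hi hpf
      · rw [ih _ hp0 hpi (hP.isContour_path p hp0 hpi)]
        have hcomp := (hP.cocycle_mk c rfl hp0 hpi α.2.1 α.2.2.1 h0 hi).symm.trans
          (hg (hP.comp_mk (pathMor p) α.1 hpi α.2.2.1 h0))
        have alg : ∀ {a b d u v w : kˣ}, w = a * b / d → a * u * (b * v) = d * (u * v * w) := by
          rintro a b d u v w rfl
          rw [mul_div_assoc, mul_mul_mul_comm, mul_comm (u * v), ← mul_assoc d, ← mul_div_assoc,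
            mul_div_cancel]
        exact (alg (congrArg Additive.toMul hcomp)).trans (congrArg _
          (hc.comp_trans (hP.isContour_path p hp0 hpi) (hα α) _ hpf).symm)
  refine ⟨e, funext fun ⟨p, q, h⟩ => ?_⟩
  change _ = p.weight _ * (q.weight _)⁻¹
  by_cases hi : IsIso (pathMor p)
  · obtain rfl := hP.eq_of_isContour_of_isIso h hi
    rw [hc.self, mul_inv_cancel]
  · have hp := hP.isContour_path p h.2 hi
    have hq : IsContour q (hP.path (pathMor p) h.2 hi) := ⟨h.1.symm.trans hp.1, h.1 ▸ h.2⟩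
    rw [key p _ h.2 hi hp, key q _ h.2 hi hq, hc.trans _ _ _ hp h hq, mul_inv,
      mul_mul_mul_comm, mul_inv_cancel, one_mul, mul_inv_cancel_right]

/-- Contour functions on weakly zigzag-finite ray-categories are exact. -/
theorem IsRayCategory.exists_eq_delta [IsAlgClosed k] (hP : IsRayCategory P)
    (hz : IsWeaklyZigzagFinite P) {c : Contour P → kˣ} (hc : IsContourFunction c) :
    ∃ e : (x y : QuiverOf P) → (x ⟶ y) → kˣ, c = delta e := by
  obtain ⟨g, hg⟩ := (hP.zigzagFree hz).exists_primitive hP.exists_closed (hP.isCocycle hc)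
  exact hP.exists_delta hc hg

end

end RayCat

theorem mainTheorem8 {k : Type w} [Field k] [IsAlgClosed k]
    {P : Type u} [Category.{v} P] [HasZeroMorphisms P]
    (hP : RayCat.IsRayCategory P)
    (hz : RayCat.IsWeaklyZigzagFinite P)
    (h3 : RayCat.AtMostThreeArrows P) :
    Subsingleton (RayCat.H P k) := by
  have htop : RayCat.exactContourFunctions P k = ⊤ :=
    eq_top_iff.2 fun c _ => hP.exists_eq_delta hz c.2
  exact QuotientGroup.subsingleton_iff.2 htop
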